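/- Let $n\ge 5$ and let $\pi=(d_1,d_2,\dots,d_n)$ be a non-increasing sequence of positive integers that is graphic, i.e. the degree sequence of some (finite) simple graph on $n$ vertices; such a graph is called a realization of $\pi$. Let $K_5-K_{1,3}$ denote the graph obtained from the complete graph $K_5$ by removing the three edges of a star $K_{1,3}$ contained in it. Then $\pi$ has a realization containing $K_5-K_{1,3}$ as a (not necessarily induced) subgraph if and only if both of the following conditions hold, where $r^t$ means that the term $r$ is repeated $t$ times: (1) $d_1\ge 4$ and $d_4\ge 3$; (2) $\pi$ is none of the sequences $(4,3^4,2)$, $(4^6)$, $(4^2,3^4)$, $(4,3^6)$, $(4^7)$, $(4,3^5,1)$, $(n-1,3^4,1^{n-5})$, and (for $n\ge 6$) $(n-1,3^5,1^{n-6})$. -/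

import Mathlib

open scoped SimpleGraph

open Classical in
/-- The simple graph `G` on the vertices `v_1, …, v_n` (indexed by `Fin n`) is a realization of the
sequence `d = (d_1, …, d_n)`: the vertex `v_i` has degree `d_i`. -/
def IsRealization {n : ℕ} (G : SimpleGraph (Fin n)) (d : Fin n → ℕ) : Prop :=
  ∀ i, G.degree i = d i

/-- A sequence is graphic if it is the degree sequence of a simple graph of order `n`. -/
def IsGraphic {n : ℕ} (d : Fin n → ℕ) : Prop :=
  ∃ G : SimpleGraph (Fin n), IsRealization G d

/-- A sequence is potentially `H`-graphic if it has a realization containing `H` as a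
(not necessarily induced) subgraph. -/
def IsPotentiallyGraphic {V : Type*} (H : SimpleGraph V) {n : ℕ} (d : Fin n → ℕ) : Prop :=
  ∃ G : SimpleGraph (Fin n), IsRealization G d ∧ H ⊑ G

/-- `K_5 - K_{1,3}`: the complete graph on `{0, 1, 2, 3, 4}` with the three edges of a star
`K_{1,3}` (centre `0`, leaves `1, 2, 3`) removed. -/
def K5MinusK13 : SimpleGraph (Fin 5) :=
  (⊤ : SimpleGraph (Fin 5)).deleteEdges {s(0, 1), s(0, 2), s(0, 3)}

/-! `K5MinusK13` is a `K_4` with one pendant edge, so a graph contains it exactly when some vertex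
of a `K_4` has degree at least four. Given a `K_4` and any vertex of degree at least four, edge
switches produce such a configuration (`exists_K4_of_deg_ge_four`). What remains is to decide which
sequences with four terms at least 3 have a realization containing `K_4`.

`good_or_exceptional` does this by induction on the number of terms. A smallest term is laid off to
the largest others (Kleitman–Wang); a `K_4` in a realization of the residual sequence survives when
the vertex is put back. This fails in two cases. If the residual has fewer than four terms at least
3, the term laid off is at most 3, and the few possible shapes are settled by explicit graphs or a
finite check. If the residual is exceptional, a finite check handles `sporadic` and the first
members of the two families `wheelLike`; a later member can only come from the next member of its
family.

Conversely, in a realization of `wheelLike` the vertex of largest degree is dominating. Deleting it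
leaves isolated vertices and a 2-regular graph on four or five vertices, a 4- or 5-cycle, which has
no triangle. For the six sporadic sequences with a term 4, an edge count around a supposed `K_4` is
violated (`IsNClique.sum_deg_le`). The other sporadic sequences have maximum 3 and are excluded by
`d_1 ≥ 4`. -/

namespace PotentialK4

open SimpleGraph

variable {V W : Type}

/-! ### Degree-preserving switches -/

/-- The degree of a vertex, as the cardinality of its set of neighbours. -/
noncomputable def deg (G : SimpleGraph V) (v : V) : ℕ := (G.neighborSet v).ncard

/-- The graph contains four pairwise adjacent vertices. -/
def HasK4 (G : SimpleGraph V) : Prop :=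
  ∃ a b c e, G.Adj a b ∧ G.Adj a c ∧ G.Adj a e ∧ G.Adj b c ∧ G.Adj b e ∧ G.Adj c e

theorem deg_eq_of_exchange [Finite V] {G G' : SimpleGraph V} {v p q : V} (hp : ¬ G.Adj v p)
    (hq : G.Adj v q) (h : ∀ w, G'.Adj v w ↔ w = p ∨ (G.Adj v w ∧ w ≠ q)) :
    deg G' v = deg G v := by
  have : G'.neighborSet v = insert p (G.neighborSet v \ {q}) := by
    ext w; simp [h]
  rw [deg, this, deg]
  exact Set.ncard_exchange (by simpa using hp) (by simpa using hq)

/-- Replacing the edges `vx`, `yz` by the non-edges `vy`, `xz` preserves all degrees. -/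
theorem exists_switch [Finite V] (G : SimpleGraph V) {v x y z : V} (hvx : G.Adj v x)
    (hyz : G.Adj y z) (hvy : ¬ G.Adj v y) (hxz : ¬ G.Adj x z) (nvy : v ≠ y) (nxz : x ≠ z) :
    ∃ G' : SimpleGraph V, (∀ w, deg G' w = deg G w) ∧
      ∀ a b, G'.Adj a b ↔ (G.Adj a b ∧ s(a, b) ≠ s(v, x) ∧ s(a, b) ≠ s(y, z)) ∨
        s(a, b) = s(v, y) ∨ s(a, b) = s(x, z) := by
  have nvx := hvx.ne
  have nyz := hyz.ne
  have nvz : v ≠ z := by rintro rfl; exact hvy hyz.symm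
  have nxy : x ≠ y := by rintro rfl; exact hvy hvx
  let G' : SimpleGraph V :=
    { Adj := fun a b => (G.Adj a b ∧ s(a, b) ≠ s(v, x) ∧ s(a, b) ≠ s(y, z)) ∨
        s(a, b) = s(v, y) ∨ s(a, b) = s(x, z)
      symm := ⟨fun a b h => by rw [Sym2.eq_swap, G.adj_comm]; exact h⟩
      loopless := ⟨fun a h => by
        rcases h with h | h | h
        · exact G.loopless.irrefl a h.1
        · simp only [Sym2.eq_iff] at h; grind
        · simp only [Sym2.eq_iff] at h; grind⟩ }
  have hG' : ∀ a b, G'.Adj a b ↔ (G.Adj a b ∧ s(a, b) ≠ s(v, x) ∧ s(a, b) ≠ s(y, z)) ∨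
        s(a, b) = s(v, y) ∨ s(a, b) = s(x, z) := fun a b => Iff.rfl
  refine ⟨G', fun w => ?_, hG'⟩
  have hxv := hvx.symm
  have hzy := hyz.symm
  have hyv : ¬ G.Adj y v := fun h => hvy h.symm
  have hzx : ¬ G.Adj z x := fun h => hxz h.symm
  by_cases h1 : w = v
  · subst h1
    exact deg_eq_of_exchange hvy hvx fun u => by rw [hG']; simp only [Sym2.eq_iff]; grind
  by_cases h2 : w = x
  · subst h2
    exact deg_eq_of_exchange hxz hxv fun u => by rw [hG']; simp only [Sym2.eq_iff]; grind
  by_cases h3 : w = y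
  · subst h3
    exact deg_eq_of_exchange hyv hyz fun u => by rw [hG']; simp only [Sym2.eq_iff]; grind
  by_cases h4 : w = z
  · subst h4
    exact deg_eq_of_exchange hzx hzy fun u => by rw [hG']; simp only [Sym2.eq_iff]; grind
  have : G'.neighborSet w = G.neighborSet w := by
    ext u; simp only [mem_neighborSet, hG', Sym2.eq_iff]; grind
  rw [deg, this, deg]

/-- Some neighbour of `y` is neither `x` nor a neighbour of `x`, if `v` is a neighbour of `x` but
not of `y` and the degree of `y` is at least that of `x`. -/
theorem exists_adj_not_adj [Finite V] (G : SimpleGraph V) {v x y : V} (hvx : G.Adj v x)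
    (hvy : ¬ G.Adj v y) (nvy : v ≠ y) (hle : deg G x ≤ deg G y) :
    ∃ z, G.Adj y z ∧ ¬ G.Adj x z ∧ x ≠ z := by
  by_contra! hcon
  have hxy : x ≠ y := by rintro rfl; exact hvy hvx
  -- Apart from `x` and `y` themselves, all neighbours of `y` would be neighbours of `x`, which also
  -- has `v`; hence `deg G y < deg G x`.
  have hsub : G.neighborSet y \ {x} ⊆ (G.neighborSet x \ {y}) \ {v} := by
    intro z hz
    simp only [Set.mem_sdiff, mem_neighborSet, Set.mem_singleton_iff] at hz ⊢
    refine ⟨⟨?_, fun h => ?_⟩, ?_⟩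
    · by_contra h
      exact hz.2 (hcon z hz.1 h).symm
    · subst h; exact G.loopless.irrefl z hz.1
    · rintro rfl; exact hvy hz.1.symm
  have h1 := Set.ncard_le_ncard hsub (Set.toFinite _)
  have h2 : ((G.neighborSet x \ {y}) \ {v}).ncard + 1 = (G.neighborSet x \ {y}).ncard :=
    Set.ncard_sdiff_singleton_add_one (by simp [hvx.symm, nvy]) (Set.toFinite _)
  unfold deg at hle
  by_cases hadj : G.Adj x y
  · have h3 := Set.ncard_sdiff_singleton_add_one (s := G.neighborSet x) (a := y)
      (by simpa using hadj) (Set.toFinite _)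
    have h4 := Set.ncard_sdiff_singleton_add_one (s := G.neighborSet y) (a := x)
      (by simpa using hadj.symm) (Set.toFinite _)
    omega
  · have h3 : G.neighborSet x \ {y} = G.neighborSet x :=
      Set.sdiff_singleton_eq_self (by simpa using hadj)
    have h4 : G.neighborSet y \ {x} = G.neighborSet y :=
      Set.sdiff_singleton_eq_self (by simpa using fun h => hadj h.symm)
    rw [h3] at h1 h2
    rw [h4] at h1
    omega

/-- Havel–Hakimi rearrangement: a vertex can be made adjacent to a prescribed set of vertices of
largest degree without changing the degrees. -/
theorem exists_neighborSet_eq [Finite V] (G : SimpleGraph V) (v : V) (S : Set V) (hv : v ∉ S)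
    (hS : S.ncard = deg G v) (hmax : ∀ s ∈ S, ∀ r ∉ S, r ≠ v → deg G r ≤ deg G s) :
    ∃ G' : SimpleGraph V, (∀ w, deg G' w = deg G w) ∧ G'.neighborSet v = S := by
  induction hm : (S \ G.neighborSet v).ncard using Nat.strong_induction_on generalizing G with
  | _ m ih =>
  by_cases hsub : S ⊆ G.neighborSet v
  · exact ⟨G, fun _ => rfl,
      (Set.eq_of_subset_of_ncard_le hsub (by rw [hS, deg]) (Set.toFinite _)).symm⟩
  obtain ⟨y, hyS, hy⟩ := Set.not_subset.1 hsub
  have hnsub : ¬ G.neighborSet v ⊆ S := fun h => hsub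
    (Set.eq_of_subset_of_ncard_le h (by rw [hS, deg]) (Set.toFinite _)).symm.subset
  obtain ⟨x, hx, hxS⟩ := Set.not_subset.1 hnsub
  rw [mem_neighborSet] at hx hy
  have nvy : v ≠ y := by rintro rfl; exact hv hyS
  -- The switch trades the neighbour `x ∉ S` of `v` for `y ∈ S`, so `S \ G.neighborSet v` shrinks.
  obtain ⟨z, hyz, hxz, nxz⟩ := exists_adj_not_adj G hx hy nvy (hmax y hyS x hxS hx.ne')
  obtain ⟨G', hdeg, hadj⟩ := exists_switch G hx hyz hy hxz nvy nxz
  have hlt : (S \ G'.neighborSet v).ncard < m := by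
    rw [← hm]
    refine Set.ncard_lt_ncard ⟨?_, ?_⟩ (Set.toFinite _)
    · intro w hw
      simp only [Set.mem_sdiff, mem_neighborSet, hadj, Sym2.eq_iff] at hw ⊢
      have : w ≠ x := by rintro rfl; exact hxS hw.1
      have : v ≠ z := by rintro rfl; exact hy hyz.symm
      grind
    · intro h
      have := h ⟨hyS, by simpa using hy⟩
      simp [hadj] at this
  obtain ⟨G'', h1, h2⟩ := ih _ hlt G' (by rw [hS, hdeg]) (by simpa only [hdeg] using hmax) rfl
  exact ⟨G'', fun w => (h1 w).trans (hdeg w), h2⟩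

/-! ### Moving a `K_4` onto a vertex of large degree -/

theorem adj_iff_of_deg_le_three [Finite V] {G : SimpleGraph V} {a b c e : V} (hb : G.Adj a b)
    (hc : G.Adj a c) (he : G.Adj a e) (hbc : b ≠ c) (hbe : b ≠ e) (hce : c ≠ e)
    (hdeg : deg G a ≤ 3) (w : V) : G.Adj a w ↔ w = b ∨ w = c ∨ w = e := by
  have h3 : ({b, c, e} : Set V).ncard = 3 := Set.ncard_eq_three.2 ⟨b, c, e, hbc, hbe, hce, rfl⟩
  have hsub : ({b, c, e} : Set V) ⊆ G.neighborSet a := by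
    rintro w (rfl | rfl | rfl) <;> assumption
  have := Set.eq_of_subset_of_ncard_le hsub (by rw [h3]; exact hdeg) (Set.toFinite _)
  rw [← mem_neighborSet, ← this]
  simp

/-- A vertex of degree at least four can be put into a `K_4` without changing the degrees. -/
theorem exists_K4_of_deg_ge_four [Finite V] (G : SimpleGraph V) (hK : HasK4 G) (u : V)
    (hu : 4 ≤ deg G u) :
    ∃ G' : SimpleGraph V, (∀ w, deg G' w = deg G w) ∧
      ∃ a b c e, (G'.Adj a b ∧ G'.Adj a c ∧ G'.Adj a e ∧ G'.Adj b c ∧ G'.Adj b e ∧ G'.Adj c e) ∧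
        4 ≤ deg G' a := by
  obtain ⟨a, b, c, e, hab, hac, hae, hbc, hbe, hce⟩ := hK
  have hba := hab.symm
  have hca := hac.symm
  have hea := hae.symm
  have hcb := hbc.symm
  have heb := hbe.symm
  have hec := hce.symm
  by_cases ha : 4 ≤ deg G a
  · exact ⟨G, fun _ => rfl, a, b, c, e, ⟨hab, hac, hae, hbc, hbe, hce⟩, ha⟩
  by_cases hb : 4 ≤ deg G b
  · exact ⟨G, fun _ => rfl, b, a, c, e, ⟨hba, hbc, hbe, hac, hae, hce⟩, hb⟩
  by_cases hc : 4 ≤ deg G c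
  · exact ⟨G, fun _ => rfl, c, a, b, e, ⟨hca, hcb, hce, hab, hae, hbe⟩, hc⟩
  by_cases he : 4 ≤ deg G e
  · exact ⟨G, fun _ => rfl, e, a, b, c, ⟨hea, heb, hec, hab, hac, hbc⟩, he⟩
  -- All four clique vertices have degree three, so the `K_4` is a component and `u` and its
  -- neighbours lie outside it.
  have Na := adj_iff_of_deg_le_three hab hac hae hbc.ne hbe.ne hce.ne (by omega)
  have Nb := adj_iff_of_deg_le_three hba hbc hbe hac.ne hae.ne hce.ne (by omega)
  have Nc := adj_iff_of_deg_le_three hca hcb hce hab.ne hae.ne hbe.ne (by omega)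
  have Ne' := adj_iff_of_deg_le_three hea heb hec hab.ne hac.ne hbc.ne (by omega)
  have nab := hab.ne
  have nac := hac.ne
  have nae := hae.ne
  have nbc := hbc.ne
  have nbe := hbe.ne
  have nce := hce.ne
  have nua : u ≠ a := by rintro rfl; exact ha hu
  have nub : u ≠ b := by rintro rfl; exact hb hu
  have nuc : u ≠ c := by rintro rfl; exact hc hu
  have nue : u ≠ e := by rintro rfl; exact he hu
  obtain ⟨T, hT, hT3⟩ := Set.exists_subset_card_eq (s := G.neighborSet u) (n := 3)
    (le_trans (by norm_num : 3 ≤ 4) hu)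
  obtain ⟨x, y, z, nxy, nxz, nyz, rfl⟩ := Set.ncard_eq_three.1 hT3
  have hx : G.Adj u x := hT (by simp)
  have hy : G.Adj u y := hT (by simp)
  have hz : G.Adj u z := hT (by simp)
  have outside : ∀ w, G.Adj u w → w ≠ a ∧ w ≠ b ∧ w ≠ c ∧ w ≠ e := by
    intro w hw
    refine ⟨?_, ?_, ?_, ?_⟩ <;> rintro rfl <;> have hw' := hw.symm
    · rw [Na] at hw'; tauto
    · rw [Nb] at hw'; tauto
    · rw [Nc] at hw'; tauto
    · rw [Ne'] at hw'; tauto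
  obtain ⟨xa, xb, xc, xe⟩ := outside x hx
  obtain ⟨ya, yb, yc, ye⟩ := outside y hy
  obtain ⟨za, zb, zc, ze⟩ := outside z hz
  -- The three switches turn `ea, eb, ec, ux, uy, uz` into `ex, ey, ez, ua, ub, uc`: `u` takes the
  -- place of `e` in the `K_4`.
  obtain ⟨G₁, d₁, h₁⟩ := exists_switch G hea hx.symm (by rw [Ne']; tauto) (by rw [Na]; tauto)
    (Ne.symm xe) (Ne.symm nua)
  simp only [Sym2.eq_iff, ne_eq] at h₁
  obtain ⟨G₂, d₂, h₂⟩ := exists_switch G₁ (v := e) (x := b) (y := y) (z := u)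
    (by rw [h₁]; grind) (by rw [h₁]; have := hy.symm; grind) (by rw [h₁, Ne']; grind)
    (by rw [h₁, Nb]; grind) (Ne.symm ye) (Ne.symm nub)
  simp only [Sym2.eq_iff, ne_eq] at h₂
  obtain ⟨G₃, d₃, h₃⟩ := exists_switch G₂ (v := e) (x := c) (y := z) (z := u)
    (by rw [h₂, h₁]; grind) (by rw [h₂, h₁]; have := hz.symm; grind) (by rw [h₂, h₁, Ne']; grind)
    (by rw [h₂, h₁, Nc]; grind) (Ne.symm ze) (Ne.symm nuc)
  simp only [Sym2.eq_iff, ne_eq] at h₃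
  have hd : ∀ w, deg G₃ w = deg G w := fun w => by rw [d₃, d₂, d₁]
  refine ⟨G₃, hd, u, a, b, c, ⟨?_, ?_, ?_, ?_, ?_, ?_⟩, by rw [hd]; exact hu⟩ <;>
    rw [h₃, h₂, h₁] <;> grind

/-! ### Degree multisets: adding and laying off a vertex -/

/-- The multiset of degrees of a finite graph. -/
noncomputable def degrees [Fintype V] (G : SimpleGraph V) : Multiset ℕ :=
  Finset.univ.val.map (deg G)

/-- A multiset of natural numbers is graphic if it consists of the degrees of a finite graph. -/
def Graphic (M : Multiset ℕ) : Prop :=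
  ∃ (V : Type) (_ : Fintype V) (G : SimpleGraph V), degrees G = M

/-- A multiset of natural numbers is good if it consists of the degrees of a finite graph
containing `K_4`. -/
def Good (M : Multiset ℕ) : Prop :=
  ∃ (V : Type) (_ : Fintype V) (G : SimpleGraph V), degrees G = M ∧ HasK4 G

theorem exists_add_of_map_eq_add (f : V → ℕ) (s : Multiset V) (T R : Multiset ℕ)
    (h : s.map f = T + R) : ∃ s₁ s₂, s = s₁ + s₂ ∧ s₁.map f = T ∧ s₂.map f = R := by
  classical
  induction T using Multiset.induction_on generalizing s with
  | empty => exact ⟨0, s, by simp, by simp, by simpa using h⟩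
  | cons a T ih =>
    rw [Multiset.cons_add] at h
    obtain ⟨v, hv, hva, hs⟩ := (Multiset.map_eq_cons f s (T + R) a).2 h
    obtain ⟨s₁, s₂, h₁, h₂, h₃⟩ := ih _ hs
    exact ⟨v ::ₘ s₁, s₂, by rw [Multiset.cons_add, ← h₁, Multiset.cons_erase hv],
      by simp [hva, h₂], h₃⟩

/-- The terms to be raised or lowered are given only as a sub-multiset of the degrees; this chooses
vertices carrying them. -/
theorem exists_finset_of_map_eq_add [DecidableEq V] (f : V → ℕ) (s : Finset V)
    (T R : Multiset ℕ) (h : s.val.map f = T + R) :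
    ∃ S ⊆ s, S.val.map f = T ∧ (s \ S).val.map f = R := by
  obtain ⟨s₁, s₂, h₁, h₂, h₃⟩ := exists_add_of_map_eq_add f s.val T R h
  have hnd : s₁.Nodup := Multiset.nodup_of_le (by rw [h₁]; exact Multiset.le_add_right _ _) s.nodup
  refine ⟨⟨s₁, hnd⟩, ?_, h₂, ?_⟩
  · exact Finset.val_le_iff.1 (by rw [h₁]; exact Multiset.le_add_right _ _)
  · rw [← h₃, Finset.sdiff_val, h₁]
    simp

/-- The graph obtained by adding a new vertex with neighbourhood `S`. -/
def addVertex (G : SimpleGraph V) (S : Set V) : SimpleGraph (Option V) where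
  Adj
    | some a, some b => G.Adj a b
    | none, some b => b ∈ S
    | some a, none => a ∈ S
    | none, none => False
  symm := ⟨by rintro (_ | a) (_ | b) h <;> first | exact h | exact h.symm⟩
  loopless := ⟨by rintro (_ | a) h; exacts [h, G.loopless.irrefl a h]⟩

theorem deg_addVertex_none (G : SimpleGraph V) (S : Set V) : deg (addVertex G S) none = S.ncard := by
  have : (addVertex G S).neighborSet none = some '' S := by
    ext (_ | b) <;> simp [addVertex]
  rw [deg, this, Set.ncard_image_of_injective _ (Option.some_injective V)]

theorem deg_addVertex_some_of_notMem (G : SimpleGraph V) (S : Set V) {v : V} (hv : v ∉ S) :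
    deg (addVertex G S) (some v) = deg G v := by
  have : (addVertex G S).neighborSet (some v) = some '' G.neighborSet v := by
    ext (_ | b) <;> simp [addVertex, hv]
  rw [deg, this, Set.ncard_image_of_injective _ (Option.some_injective V), deg]

theorem deg_addVertex_some_of_mem [Finite V] (G : SimpleGraph V) (S : Set V) {v : V} (hv : v ∈ S) :
    deg (addVertex G S) (some v) = deg G v + 1 := by
  have : (addVertex G S).neighborSet (some v) = insert none (some '' G.neighborSet v) := by
    ext (_ | b) <;> simp [addVertex, hv]
  rw [deg, this, Set.ncard_insert_of_notMem (by simp) (Set.toFinite _),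
    Set.ncard_image_of_injective _ (Option.some_injective V), deg]

theorem degrees_addVertex [Fintype V] [DecidableEq V] (G : SimpleGraph V) (S : Finset V) :
    degrees (addVertex G S) =
      S.card ::ₘ ((S.val.map (deg G)).map Nat.succ + (Finset.univ \ S).val.map (deg G)) := by
  have huniv : (Finset.univ : Finset V).val = S.val + (Finset.univ \ S).val := by
    rw [Finset.sdiff_val, add_tsub_cancel_of_le (Finset.val_le_iff.2 (Finset.subset_univ S))]
  have hopt : (Finset.univ : Finset (Option V)).val = none ::ₘ Finset.univ.val.map some := rfl
  rw [degrees, hopt, Multiset.map_cons, Multiset.map_map, deg_addVertex_none, huniv,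
    Multiset.map_add, Set.ncard_coe_finset, Multiset.map_map]
  congr 2
  · exact Multiset.map_congr rfl fun v hv => deg_addVertex_some_of_mem G _ (by simpa using hv)
  · exact Multiset.map_congr rfl fun v hv =>
      deg_addVertex_some_of_notMem G _ (by simpa using Finset.mem_sdiff.1 (Finset.mem_def.2 hv))

/-- Adding a vertex to a realization containing `K_4`. -/
theorem Good.addVertex {T R : Multiset ℕ} (h : Good (T + R)) :
    Good (T.card ::ₘ (T.map Nat.succ + R)) := by
  classical
  obtain ⟨V, _, G, hd, a, b, c, e, hK⟩ := h
  obtain ⟨S, -, hT, hR⟩ := exists_finset_of_map_eq_add (deg G) Finset.univ T R hd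
  refine ⟨Option V, inferInstance, PotentialK4.addVertex G S, ?_, some a, some b, some c, some e, hK⟩
  rw [degrees_addVertex, hT, hR, ← hT, Multiset.card_map]
  rfl

/-- The Kleitman–Wang reduction: a term `k` can be laid off to `k` largest other terms. -/
theorem Graphic.layOff {k : ℕ} {T R : Multiset ℕ} (h : Graphic (k ::ₘ (T + R))) (hT : T.card = k)
    (hmax : ∀ t ∈ T, ∀ r ∈ R, r ≤ t) : Graphic (T.map Nat.pred + R) := by
  classical
  obtain ⟨V, _, G₀, hd₀⟩ := h
  obtain ⟨v, hv, hvk, hrest⟩ := (Multiset.map_eq_cons (deg G₀) _ (T + R) k).2 hd₀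
  rw [← Finset.erase_val] at hrest
  obtain ⟨S, hSs, hST, hSR⟩ := exists_finset_of_map_eq_add (deg G₀) _ T R hrest
  have hvS : v ∉ S := fun h => by simpa using hSs h
  -- Once the neighbours of `v` are exactly `S`, deleting `v` lowers precisely the degrees on `S`.
  obtain ⟨G, hdeg, hN⟩ := exists_neighborSet_eq G₀ v (S : Set V) (by simpa using hvS)
    (by rw [Set.ncard_coe_finset, hvk, ← hT, ← hST, Multiset.card_map]; rfl)
    (by
      intro s hs r hr hrv
      refine hmax _ ?_ _ ?_
      · rw [← hST]; exact Multiset.mem_map_of_mem _ hs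
      · rw [← hSR]; exact Multiset.mem_map_of_mem _
          (Finset.mem_def.1 (Finset.mem_sdiff.2 ⟨by simp [hrv], by simpa using hr⟩)))
  have hadj : ∀ w, G.Adj w v ↔ w ∈ S := fun w => by
    rw [G.adj_comm, ← mem_neighborSet, hN, Finset.mem_coe]
  let U : Finset V := Finset.univ.erase v
  let H : SimpleGraph U := G.comap Subtype.val
  have hN' : ∀ w : U, Subtype.val '' H.neighborSet w = G.neighborSet w.1 \ {v} := by
    intro w
    ext x
    simp only [H, U, Set.mem_image, mem_neighborSet, comap_adj, Subtype.exists, Set.mem_sdiff,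
      Set.mem_singleton_iff]
    constructor
    · rintro ⟨y, hy, hwy, rfl⟩
      exact ⟨hwy, by simpa using hy⟩
    · rintro ⟨hwx, hx⟩
      exact ⟨x, by simpa using hx, hwx, rfl⟩
  have hdH : ∀ w : U, deg H w = if w.1 ∈ S then (deg G₀ w.1).pred else deg G₀ w.1 := by
    intro w
    rw [deg, ← Set.ncard_image_of_injective _ Subtype.val_injective, hN', ← hdeg]
    split_ifs with h
    · rw [Set.ncard_sdiff_singleton_of_mem (by simpa [hadj] using h)]; rfl
    · rw [Set.sdiff_singleton_eq_self (by simpa [hadj] using h)]; rfl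
  have hU : U.val = S.val + (U \ S).val := by
    rw [Finset.sdiff_val, add_tsub_cancel_of_le (Finset.val_le_iff.2 hSs)]
  refine ⟨U, inferInstance, H, ?_⟩
  have h1 : degrees H = U.val.map (fun w => if w ∈ S then (deg G₀ w).pred else deg G₀ w) := by
    rw [degrees, Finset.univ_eq_attach, Finset.attach_val,
      ← Multiset.attach_map_val' U.val (fun w => if w ∈ S then (deg G₀ w).pred else deg G₀ w)]
    exact Multiset.map_congr rfl fun w _ => hdH w
  rw [h1, hU, Multiset.map_add, ← hST, ← hSR, Multiset.map_map]
  congr 1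
  · exact Multiset.map_congr rfl fun w hw => by
      simp [Finset.mem_def, hw]
  · exact Multiset.map_congr rfl fun w hw => by
      exact if_neg (Finset.mem_sdiff.1 (Finset.mem_def.2 hw)).2

theorem deg_eq_degree [Fintype V] (G : SimpleGraph V) [DecidableRel G.Adj] (v : V) :
    deg G v = G.degree v := by
  rw [deg, Set.ncard_eq_toFinset_card', ← card_neighborFinset_eq_degree]
  rfl

theorem Graphic.even_sum {M : Multiset ℕ} (h : Graphic M) : Even M.sum := by
  classical
  obtain ⟨V, _, G, rfl⟩ := h
  have : (degrees G).sum = ∑ v, G.degree v := by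
    rw [degrees, Finset.sum]
    congr 1
    exact Multiset.map_congr rfl fun v _ => deg_eq_degree G v
  rw [this, G.sum_degrees_eq_twice_card_edges]
  exact even_two_mul _

theorem Graphic.lt_card {M : Multiset ℕ} (h : Graphic M) {x : ℕ} (hx : x ∈ M) : x < M.card := by
  classical
  obtain ⟨V, _, G, rfl⟩ := h
  obtain ⟨v, -, rfl⟩ := Multiset.mem_map.1 hx
  rw [deg_eq_degree, degrees, Multiset.card_map]
  exact G.degree_lt_card_verts v

theorem good_K4 : Good {3, 3, 3, 3} := by
  classical
  refine ⟨Fin 4, inferInstance, ⊤, ?_, 0, 1, 2, 3, by decide⟩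
  have : ∀ v : Fin 4, deg (⊤ : SimpleGraph (Fin 4)) v = 3 := fun v => by
    rw [deg_eq_degree]; simp
  rw [degrees, Multiset.map_congr rfl fun v _ => this v]
  rfl

/-! ### Small sequences and the list of exceptions -/

/-- The number of terms of `M` that are at least three. -/
def big (M : Multiset ℕ) : ℕ := M.countP (3 ≤ ·)

/-- The sequence obtained from `l` by adding a vertex joined to vertices with degrees `t`. -/
def extend (l t : List ℕ) : List ℕ :=
  -- The test says that `t` is a sub-multiset of `l`; otherwise `l` is left unchanged, so
  -- `good_extend` needs no hypothesis on `t`.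
  if (t ++ l.diff t).Perm l then t.length :: (t.map Nat.succ ++ l.diff t) else l

/-- The sequence obtained from that of `K_4` by successively adding vertices. -/
def build (c : List (List ℕ)) : List ℕ := (c.foldl extend [3, 3, 3, 3]).insertionSort (· ≥ ·)

theorem good_extend {l : List ℕ} (t : List ℕ) (h : Good l) : Good (extend l t) := by
  unfold extend
  split_ifs with hp
  · have : Good ((t : Multiset ℕ) + (l.diff t : List ℕ)) := by
      rw [Multiset.coe_add, Multiset.coe_eq_coe.2 hp]; exact h
    simpa using this.addVertex
  · exact h

theorem good_build (c : List (List ℕ)) : Good (build c) := by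
  have key : ∀ (c : List (List ℕ)) (l : List ℕ), Good l → Good (Multiset.ofList (c.foldl extend l)) := by
    intro c
    induction c with
    | nil => exact fun l h => h
    | cons t c ih => exact fun l h => ih _ (good_extend t h)
  rw [build, Multiset.coe_eq_coe.2 (List.perm_insertionSort _ _)]
  exact key c _ good_K4

/-- Ways to build realizations containing `K_4` of the small sequences that reduce to an exception. -/
def recipes : List (List (List ℕ)) :=
  [[],
   [[3], [1]], [[3], [1], [1]], [[3], [1], [2]], [[3], [1], [2], [1]], [[3], [1], [2, 1]],
   [[3], [1], [2], [1], [2]], [[3], [1], [2, 1], [2]], [[3], [1], [2, 1], [2], [2]],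
   [[3], [1], [2, 1], [2, 2]], [[3], [3, 1]], [[3], [3], [1, 1]], [[3, 3], [2]],
   [[3, 3], [2], [1]], [[3, 3], [2], [1], [2]], [[3], [3, 1], [2, 2]], [[3, 3], [2], [1], [2, 1]],
   [[3], [3, 1], [2, 2], [2]], [[3], [3], [1, 1], [2, 2, 2]], [[3, 3], [3, 2]],
   [[3, 3], [3], [2, 1]], [[3, 3], [3, 2], [2]], [[3], [3, 1], [3, 2, 2]],
   [[3, 3], [3], [2, 1], [2, 2]], [[3, 3], [3, 3, 2]], [[3, 3], [3, 3], [2, 2]],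
   [[3, 3], [3], [3, 1], [2, 2, 2]], [[3, 3], [3, 2], [3, 3, 2]], [[3], [4, 1], [2]],
   [[3], [4, 1], [2], [2]], [[3], [4, 1], [2, 2]], [[3], [4, 1], [2, 2], [2]], [[3, 3], [4, 2]],
   [[3, 3], [4], [2, 1]], [[3, 3], [4, 2], [2]], [[3], [4, 1], [3, 2, 2]],
   [[3, 3], [4], [2, 1], [2, 2]], [[3, 3], [4, 3, 2]], [[3, 3], [4, 3], [2, 2]],
   [[3, 3], [4], [3, 1], [2, 2, 2]], [[3, 3], [4, 3], [3, 2, 2]], [[3, 3, 3], [4, 3, 3], [3]],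
   [[3, 3], [4, 3, 2], [3, 3, 3], [3]], [[3, 3], [4, 4], [2, 2]], [[3, 3], [4, 4], [3, 2, 2]],
   [[3, 3, 3], [4, 4, 3], [3, 3]], [[3, 3, 3], [4, 4], [3, 3, 2], [3, 3]],
   [[3, 3, 3], [4, 4, 4], [3, 3, 3]], [[3, 3, 3], [4, 4], [4, 3, 2], [3, 3, 3]],
   [[3, 3, 3], [4, 4, 3], [4, 4, 3, 3]], [[3, 3, 3], [4, 4], [4, 3, 2], [4, 3, 3, 3]],
   [[3, 3], [4, 2], [5, 2]], [[3, 3], [4, 3], [5, 2, 2]]]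

/-- The exceptional sequences outside the two infinite families. -/
def sporadic : List (List ℕ) :=
  [[3, 3, 3, 3, 2], [4, 4, 4, 4, 4, 4], [4, 4, 3, 3, 3, 3], [4, 3, 3, 3, 3, 2], [3, 3, 3, 3, 3, 3],
   [3, 3, 3, 3, 3, 1], [3, 3, 3, 3, 2, 2], [4, 4, 4, 4, 4, 4, 4], [4, 3, 3, 3, 3, 3, 3],
   [4, 3, 3, 3, 3, 3, 1], [3, 3, 3, 3, 3, 3, 2], [3, 3, 3, 3, 3, 2, 1], [3, 3, 3, 3, 3, 3, 3, 1],
   [3, 3, 3, 3, 3, 3, 1, 1]]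

/-- The sequence `(j + s, 3^s, 1^j)`. -/
def wheelLike (s j : ℕ) : Multiset ℕ :=
  (j + s) ::ₘ (Multiset.replicate s 3 + Multiset.replicate j 1)

/-- The sequences with at least four terms that are at least three, all of whose realizations are
`K_4`-free. -/
def Exceptional (M : Multiset ℕ) : Prop :=
  (∃ l ∈ sporadic, M = l) ∨ ∃ s j, (s = 4 ∨ s = 5) ∧ M = wheelLike s j

/-- The small members of the infinite families. -/
def smallWheelLike : List (List ℕ) :=
  [[4, 3, 3, 3, 3], [5, 3, 3, 3, 3, 3], [5, 3, 3, 3, 3, 1], [6, 3, 3, 3, 3, 3, 1]]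

/-- The small sequences whose status is known. -/
def known : List (List ℕ) := recipes.map build ++ sporadic ++ smallWheelLike

theorem good_or_exceptional_of_known {l : List ℕ} (h : l.insertionSort (· ≥ ·) ∈ known) :
    Good l ∨ Exceptional l := by
  rw [← Multiset.coe_eq_coe.2 (List.perm_insertionSort (· ≥ ·) l)]
  generalize l.insertionSort (· ≥ ·) = m at h
  rw [known, List.mem_append, List.mem_append] at h
  rcases h with (h | h) | h
  · obtain ⟨c, -, rfl⟩ := List.mem_map.1 h
    exact Or.inl (good_build c)
  · exact Or.inr (Or.inl ⟨m, h, rfl⟩)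
  · simp only [smallWheelLike, List.mem_cons, List.not_mem_nil, or_false] at h
    rcases h with rfl | rfl | rfl | rfl
    · exact Or.inr (Or.inr ⟨4, 0, Or.inl rfl, rfl⟩)
    · exact Or.inr (Or.inr ⟨5, 0, Or.inr rfl, rfl⟩)
    · exact Or.inr (Or.inr ⟨4, 1, Or.inl rfl, rfl⟩)
    · exact Or.inr (Or.inr ⟨5, 1, Or.inr rfl, rfl⟩)

/-- All but the last alternative rule out a choice `t`: the laid-off term is not smallest, the
raised terms are not largest, fewer than four terms are at least 3, or the new term is 0. -/
theorem layOff_exceptions_check :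
    (sporadic ++ smallWheelLike.take 2).all (fun l => l.sublists.all fun t =>
      t.any (fun x => decide (x + 1 < t.length)) ||
      (l.diff t).any (fun y => decide (y < t.length) || t.any fun x => decide (x + 1 < y)) ||
      decide ((t.length :: (t.map Nat.succ ++ l.diff t)).countP (3 ≤ ·) < 4) ||
      decide (t.length = 0) ||
      decide ((t.length :: (t.map Nat.succ ++ l.diff t)).insertionSort (· ≥ ·) ∈ known)) = true := by
  decide +kernel

/-! ### Laying off a smallest term; exceptional residuals -/

theorem Graphic.of_addVertex {T R : Multiset ℕ} (h : Graphic (T.card ::ₘ (T.map Nat.succ + R)))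
    (htop : ∀ t ∈ T, ∀ r ∈ R, r ≤ t + 1) : Graphic (T + R) := by
  have := h.layOff (by simp) (by simpa using htop)
  simpa [Multiset.map_map] using this

theorem exists_top (s : Multiset ℕ) (j : ℕ) (hj : j ≤ s.card) :
    ∃ T R : Multiset ℕ, s = T + R ∧ T.card = j ∧ ∀ t ∈ T, ∀ r ∈ R, r ≤ t := by
  let l := s.sort (· ≥ ·)
  have hl : (l : Multiset ℕ) = s := s.sort_eq _
  have hp : l.Pairwise (· ≥ ·) := s.pairwise_sort _
  have hlen : l.length = s.card := by rw [← hl]; rfl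
  refine ⟨l.take j, l.drop j, ?_, ?_, ?_⟩
  · rw [Multiset.coe_add, List.take_append_drop, hl]
  · rw [Multiset.coe_card, List.length_take, hlen, min_eq_left hj]
  · rw [← List.take_append_drop j l, List.pairwise_append] at hp
    exact fun t ht r hr => hp.2.2 t ht r hr

/-- Every nonempty graphic sequence arises from laying off a smallest term to largest terms. -/
theorem Graphic.exists_layOff {M : Multiset ℕ} (h : Graphic M) (hne : M ≠ 0)
    (hpos : ∀ x ∈ M, 1 ≤ x) :
    ∃ T R : Multiset ℕ, M = T.card ::ₘ (T.map Nat.succ + R) ∧ (∀ x ∈ M, T.card ≤ x) ∧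
      ∀ t ∈ T, ∀ r ∈ R, r ≤ t + 1 := by
  obtain ⟨k, hk, hmin⟩ : ∃ k ∈ M, ∀ x ∈ M, k ≤ x := by
    obtain ⟨k, hk, hmin⟩ := M.toFinset.exists_min_image id
      (by rw [Multiset.toFinset_nonempty]; exact hne)
    exact ⟨k, by simpa using hk, fun x hx => hmin x (by simpa using hx)⟩
  obtain ⟨M', rfl⟩ := Multiset.exists_cons_of_mem hk
  obtain ⟨T', R, rfl, hT, htop⟩ := exists_top M' k (by have := h.lt_card hk; simp at this; omega)
  have hsucc : (T'.map Nat.pred).map Nat.succ = T' := by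
    rw [Multiset.map_map]
    conv_rhs => rw [← Multiset.map_id T']
    refine Multiset.map_congr rfl fun x hx => ?_
    have := hpos x (by simp [hx])
    simp only [Function.comp, id]
    exact Nat.succ_pred_eq_of_pos this
  refine ⟨T'.map Nat.pred, R, ?_, ?_, ?_⟩
  · rw [hsucc, Multiset.card_map, hT]
  · rw [Multiset.card_map, hT]; exact hmin
  · intro t ht r hr
    obtain ⟨t', ht', rfl⟩ := Multiset.mem_map.1 ht
    have := htop t' ht' r hr
    simp only [Nat.pred_eq_sub_one] at *
    omega

theorem good_or_exceptional_of_layOff_known {T R : Multiset ℕ} {l : List ℕ}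
    (hl : l ∈ sporadic ++ smallWheelLike.take 2) (hTR : T + R = l)
    (hmin : ∀ x ∈ T.card ::ₘ (T.map Nat.succ + R), T.card ≤ x) (hpos : T.card ≠ 0)
    (htop : ∀ t ∈ T, ∀ r ∈ R, r ≤ t + 1)
    (hbig : 4 ≤ big (T.card ::ₘ (T.map Nat.succ + R))) :
    Good (T.card ::ₘ (T.map Nat.succ + R)) ∨ Exceptional (T.card ::ₘ (T.map Nat.succ + R)) := by
  obtain ⟨t, hts, rfl⟩ : ∃ t : List ℕ, t.Sublist l ∧ (t : Multiset ℕ) = T := by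
    have hle : T ≤ (l : Multiset ℕ) := by rw [← hTR]; exact Multiset.le_add_right _ _
    induction T using Quotient.inductionOn with
    | _ t₀ =>
      obtain ⟨t, ht, hs⟩ := (Multiset.coe_le.1 hle : t₀.Subperm l)
      exact ⟨t, hs, Multiset.coe_eq_coe.2 ht⟩
  have hR : R = (l.diff t : List ℕ) := by
    rw [← Multiset.coe_sub, ← hTR, add_tsub_cancel_left]
  subst hR
  have hM : ((t : Multiset ℕ).card ::ₘ ((t : Multiset ℕ).map Nat.succ + (l.diff t : List ℕ))) =
      ((t.length :: (t.map Nat.succ ++ l.diff t) : List ℕ) : Multiset ℕ) := by simp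
  rw [hM] at hbig hmin ⊢
  apply good_or_exceptional_of_known
  have := layOff_exceptions_check
  rw [List.all_eq_true] at this
  have := this l hl
  rw [List.all_eq_true] at this
  have := this t (List.mem_sublists.2 hts)
  simp only [Bool.or_eq_true, List.any_eq_true, decide_eq_true_eq] at this
  simp only [Multiset.mem_coe, List.mem_cons, List.mem_append, List.mem_map,
    Multiset.coe_card] at hmin htop hpos
  rcases this with (((⟨x, hx, h⟩ | ⟨y, hy, h⟩) | h) | h) | h
  · have := hmin (x + 1) (Or.inr (Or.inl ⟨x, hx, rfl⟩))
    omega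
  · rcases h with h | ⟨x, hx, h⟩
    · have := hmin y (Or.inr (Or.inr hy))
      omega
    · have := htop x hx y hy
      omega
  · rw [big, Multiset.coe_countP] at hbig
    omega
  · exact absurd h hpos
  · exact h

/-- A term 1 must remain in `R`, since otherwise at most two terms of the residual would be at least
3. Hence the laid-off term is 1, and it was joined to the largest term, which gives the next member
of the family. -/
theorem exceptional_of_layOff_wheelLike {T R : Multiset ℕ} {s j : ℕ} (hs : s = 4 ∨ s = 5)
    (hTR : T + R = wheelLike s (j + 1))
    (hmin : ∀ x ∈ T.card ::ₘ (T.map Nat.succ + R), T.card ≤ x) (hpos : T.card ≠ 0)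
    (htop : ∀ t ∈ T, ∀ r ∈ R, r ≤ t + 1) :
    Exceptional (T.card ::ₘ (T.map Nat.succ + R)) := by
  have hmem : ∀ x, x ∈ T ∨ x ∈ R ↔ x = j + 1 + s ∨ x = 3 ∨ x = 1 := by
    intro x
    rw [← Multiset.mem_add, hTR, wheelLike]
    have : s ≠ 0 := by omega
    simp [Multiset.mem_replicate, this]
    tauto
  have hcount : big T + big R = s + 1 := by
    have := congrArg big hTR
    simp only [big, Multiset.countP_add, wheelLike, Multiset.countP_cons] at this ⊢
    rw [this]
    have h1 : (Multiset.replicate s 3).countP (3 ≤ ·) = s := by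
      rw [Multiset.countP_eq_card.2]
      · simp
      · intro x hx; rw [Multiset.eq_of_mem_replicate hx]
    have h2 : (Multiset.replicate (j + 1) 1).countP (3 ≤ ·) = 0 := by
      rw [Multiset.countP_eq_zero]
      intro x hx; rw [Multiset.eq_of_mem_replicate hx]; norm_num
    rw [h1, h2, if_pos (by omega)]
  have h1R : 1 ∈ R := by
    rcases (hmem 1).2 (by simp) with h | h
    · have hk := hmin 2 (by simp only [Multiset.mem_cons, Multiset.mem_add, Multiset.mem_map];
                            exact Or.inr (Or.inl ⟨1, h, rfl⟩))
      have hR0 : big R = 0 := by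
        rw [big, Multiset.countP_eq_zero]
        intro x hx
        have := htop 1 h x hx
        omega
      have : big T ≤ T.card := Multiset.countP_le_card _ _
      omega
    · exact h
  have hk := hmin 1 (by simp [h1R])
  obtain ⟨t, rfl⟩ := Multiset.card_eq_one.1 (by omega : T.card = 1)
  have ht : t = j + 1 + s := by
    rcases (hmem t).1 (by simp) with h | h | h
    · exact h
    · rcases (hmem (j + 1 + s)).2 (by simp) with h' | h'
      · simpa using (Multiset.mem_singleton.1 h').symm
      · have := htop t (by simp) _ h'
        omega
    · rcases (hmem (j + 1 + s)).2 (by simp) with h' | h'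
      · simpa using (Multiset.mem_singleton.1 h').symm
      · have := htop t (by simp) _ h'
        omega
  subst ht
  rw [wheelLike, Multiset.singleton_add, Multiset.cons_inj_right] at hTR
  refine Or.inr ⟨s, j + 2, hs, ?_⟩
  rw [hTR, wheelLike, Multiset.replicate_succ 1 (j + 1), Multiset.add_cons]
  simp only [Multiset.card_singleton, Multiset.map_singleton, Multiset.singleton_add]
  rw [Multiset.cons_swap]
  congr 1
  omega

/-! ### Attaching edges, paths and cycles -/

theorem good_isolated_edge {R : Multiset ℕ} (h : Good R) : Good (1 ::ₘ 1 ::ₘ R) := by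
  have h0 : Good (0 ::ₘ R) := by
    have := Good.addVertex (T := 0) (R := R) (by simpa using h)
    simpa using this
  simpa using Good.addVertex (T := {0}) (R := R) (by simpa using h0)

/-- Each new vertex is hung on the current leaf, which gets degree 2 and passes on the role of leaf.
-/
theorem good_extend_path {R : Multiset ℕ} (p : ℕ) (h : Good (1 ::ₘ R)) :
    Good (1 ::ₘ (Multiset.replicate p 2 + R)) := by
  induction p with
  | zero => simpa using h
  | succ p ih =>
    have := Good.addVertex (T := {1}) (R := Multiset.replicate p 2 + R) (by simpa using ih)
    simpa [Multiset.replicate_succ] using this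

/-- A disjoint path, closed by a vertex joined to both its ends. -/
theorem good_cycle {R : Multiset ℕ} (p : ℕ) (h : Good R) :
    Good (Multiset.replicate (p + 3) 2 + R) := by
  have h1 := good_extend_path p (good_isolated_edge h)
  have := Good.addVertex (T := {1, 1}) (R := Multiset.replicate p 2 + R) (by
    simpa [Multiset.add_cons, Multiset.cons_add] using h1)
  simpa [Multiset.replicate_succ, Multiset.cons_add] using this

/-- A cycle with `p + 3` vertices is glued on at the vertex of degree `x`. -/
theorem good_ear {R : Multiset ℕ} (x p : ℕ) (h : Good (x ::ₘ R)) :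
    Good ((x + 2) ::ₘ (Multiset.replicate (p + 2) 2 + R)) := by
  have h1 := Good.addVertex (T := {x}) (R := R) (by simpa using h)
  simp only [Multiset.card_singleton, Multiset.map_singleton, Multiset.singleton_add] at h1
  have h2 := good_extend_path p h1
  have := Good.addVertex (T := {1, x + 1}) (R := Multiset.replicate p 2 + R) (by
    simpa [Multiset.add_cons, Multiset.cons_add] using h2)
  convert this using 1
  simp only [Multiset.replicate_succ, Multiset.cons_add, Multiset.insert_eq_cons,
    Multiset.map_cons, Multiset.map_singleton, Multiset.card_cons, Multiset.card_singleton,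
    Multiset.singleton_add]
  rw [Multiset.cons_swap (x + 2), Multiset.cons_swap (x + 2)]

/-- One vertex of a `K_4` carries `h` triangles and one further cycle that absorbs the remaining
terms 2. -/
theorem good_friendship (h p : ℕ) (hp : 2 * h ≤ p) :
    Good ((2 * h + 5) ::ₘ (Multiset.replicate (p + 2) 2 + Multiset.replicate 3 3)) := by
  induction h generalizing p with
  | zero => exact good_ear 3 p good_K4
  | succ h ih =>
    obtain ⟨q, rfl⟩ : ∃ q, p = q + 2 := ⟨p - 2, by omega⟩
    have := good_ear _ 0 (ih q (by omega))
    rwa [← add_assoc, ← Multiset.replicate_add, show 0 + 2 + (q + 2) = q + 2 + 2 by ring,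
      show 2 * h + 5 + 2 = 2 * (h + 1) + 5 by ring] at this

/-- The `K_4` is a component, and the remaining terms form a cycle, or a path together with isolated
edges. This fails only for `q = 0` and `p = 1` or `p = 2`. -/
theorem good_or_exceptional_four_threes {p q : ℕ}
    (h : Graphic (Multiset.replicate 4 3 + (Multiset.replicate p 2 + Multiset.replicate q 1))) :
    Good (Multiset.replicate 4 3 + (Multiset.replicate p 2 + Multiset.replicate q 1)) ∨
      Exceptional
        (Multiset.replicate 4 3 + (Multiset.replicate p 2 + Multiset.replicate q 1)) := by
  have heven : Even q := by
    have := h.even_sum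
    simp only [Multiset.sum_add, Multiset.sum_replicate, smul_eq_mul] at this
    rw [Nat.even_iff] at this ⊢
    omega
  obtain ⟨m, rfl⟩ := heven
  rw [add_comm (Multiset.replicate 4 3)]
  rcases m with _ | m
  · match p with
    | 0 => exact Or.inl good_K4
    | 1 => exact Or.inr (Or.inl ⟨[3, 3, 3, 3, 2], by decide, by decide⟩)
    | 2 => exact Or.inr (Or.inl ⟨[3, 3, 3, 3, 2, 2], by decide, by decide⟩)
    | p + 3 =>
      left
      simpa using good_cycle p good_K4
  · left
    have key : ∀ m : ℕ, Good (Multiset.replicate (m + m) 1 + Multiset.replicate 4 3) := by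
      intro m
      induction m with
      | zero => exact good_K4
      | succ m ih =>
        have := good_isolated_edge ih
        rw [show m + 1 + (m + 1) = m + m + 1 + 1 by ring, Multiset.replicate_succ,
          Multiset.replicate_succ, Multiset.cons_add, Multiset.cons_add]
        exact this
    have := good_extend_path p (good_isolated_edge (key m))
    convert this using 1
    rw [show m + 1 + (m + 1) = m + m + 1 + 1 by ring, Multiset.replicate_succ,
      Multiset.replicate_succ]
    simp only [Multiset.add_cons, Multiset.cons_add, add_assoc]

/-! ### Residuals with fewer than four terms at least 3 -/

theorem big_cons (x : ℕ) (M : Multiset ℕ) : big (x ::ₘ M) = big M + if 3 ≤ x then 1 else 0 := by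
  rw [big, Multiset.countP_cons, big]

theorem big_add (M N : Multiset ℕ) : big (M + N) = big M + big N := Multiset.countP_add _ _ _

theorem big_eq_card {M : Multiset ℕ} (h : ∀ x ∈ M, 3 ≤ x) : big M = M.card :=
  Multiset.countP_eq_card.2 h

theorem exists_eq_replicate {R : Multiset ℕ} (h : ∀ x ∈ R, 1 ≤ x ∧ x ≤ 3) :
    ∃ p q, R = Multiset.replicate (big R) 3 + (Multiset.replicate p 2 + Multiset.replicate q 1) := by
  induction R using Multiset.induction_on with
  | empty => exact ⟨0, 0, rfl⟩
  | cons a R ih =>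
    obtain ⟨p, q, hR⟩ := ih fun x hx => h x (Multiset.mem_cons_of_mem hx)
    obtain ⟨h1, h3⟩ := h a (Multiset.mem_cons_self a R)
    rw [big_cons]
    generalize big R = c at hR
    subst hR
    interval_cases a
    · exact ⟨p, q + 1, by simp [Multiset.replicate_succ, Multiset.add_cons]⟩
    · exact ⟨p + 1, q, by simp [Multiset.replicate_succ, Multiset.add_cons, Multiset.cons_add]⟩
    · exact ⟨p, q, by simp [Multiset.replicate_succ, Multiset.cons_add]⟩

/-- The ranges suffice because at most three terms 3 stay untouched, so there are at most seven
terms in all and each is at most 6. -/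
theorem layOff_three_check :
    (List.range 4).all (fun r => (List.range 6).all fun x => (List.range 6).all fun y =>
      (List.range 6).all fun z =>
        decide (x < 2) || decide (y < 2) || decide (z < 2) || decide (3 + r ≤ x) ||
        decide (3 + r ≤ y) || decide (3 + r ≤ z) || decide ((x + y + z + r * 3) % 2 = 1) ||
        decide (4 ≤ [x, y, z].countP (3 ≤ ·) + r) ||
        decide ((3 :: (x + 1) :: (y + 1) :: (z + 1) :: List.replicate r 3).insertionSort (· ≥ ·)
          ∈ known)) = true := by
  decide +kernel

theorem good_or_exceptional_of_layOff_three {x y z : ℕ} {R : Multiset ℕ}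
    (hG : Graphic (3 ::ₘ (x + 1) ::ₘ (y + 1) ::ₘ (z + 1) ::ₘ R))
    (hx : 2 ≤ x) (hy : 2 ≤ y) (hz : 2 ≤ z) (hR : ∀ r ∈ R, 3 ≤ r)
    (htop : ∀ r ∈ R, r ≤ x + 1 ∧ r ≤ y + 1 ∧ r ≤ z + 1)
    (hN : big (x ::ₘ y ::ₘ z ::ₘ R) < 4) :
    Good (3 ::ₘ (x + 1) ::ₘ (y + 1) ::ₘ (z + 1) ::ₘ R) ∨
      Exceptional (3 ::ₘ (x + 1) ::ₘ (y + 1) ::ₘ (z + 1) ::ₘ R) := by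
  obtain ⟨c, rfl⟩ : ∃ c, R = Multiset.replicate c 3 := by
    refine ⟨R.card, Multiset.eq_replicate.2 ⟨rfl, fun r hr => ?_⟩⟩
    -- A term of `R` above 3 would force `x, y, z ≥ 3`, making four residual terms at least 3.
    by_contra hne
    have h3 := hR r hr
    obtain ⟨h1, h2, h3⟩ := htop r hr
    have : 0 < big R := Multiset.countP_pos.2 ⟨r, hr, by omega⟩
    simp only [big_cons] at hN
    rw [if_pos (by omega), if_pos (by omega), if_pos (by omega)] at hN
    omega
  have hcard : ∀ w ∈ 3 ::ₘ (x + 1) ::ₘ (y + 1) ::ₘ (z + 1) ::ₘ Multiset.replicate c 3,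
      w < c + 4 := fun w hw => by
    have := hG.lt_card hw
    simp only [Multiset.card_cons, Multiset.card_replicate] at this
    omega
  have hx' := hcard (x + 1) (by simp)
  have hy' := hcard (y + 1) (by simp)
  have hz' := hcard (z + 1) (by simp)
  have heven := hG.even_sum
  simp only [Multiset.sum_cons, Multiset.sum_replicate, smul_eq_mul, Nat.even_iff] at heven
  simp only [big_cons, big_eq_card hR, Multiset.card_replicate] at hN
  have hM : (3 ::ₘ (x + 1) ::ₘ (y + 1) ::ₘ (z + 1) ::ₘ Multiset.replicate c 3) =
      ((3 :: (x + 1) :: (y + 1) :: (z + 1) :: List.replicate c 3 : List ℕ) : Multiset ℕ) := by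
    simp only [← Multiset.cons_coe, Multiset.coe_replicate]
  rw [hM]
  apply good_or_exceptional_of_known
  have := layOff_three_check
  simp only [List.all_eq_true, List.mem_range] at this
  have := this c (by omega) x (by omega) y (by omega) z (by omega)
  simp only [Bool.or_eq_true, decide_eq_true_eq, List.countP_cons, List.countP_nil] at this
  rcases this with (((((((h | h) | h) | h) | h) | h) | h) | h) | h
  · omega
  · omega
  · omega
  · omega
  · omega
  · omega
  · omega
  · omega
  · exact h

/-- The number of terms at least 3 can drop below four only if the lowered term was a 3; the others
are then at most 3, exactly three of them equal to 3. -/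
theorem good_or_exceptional_of_layOff_one {t : ℕ} {R : Multiset ℕ}
    (hG : Graphic (1 ::ₘ (t + 1) ::ₘ R)) (hR : ∀ r ∈ R, 1 ≤ r ∧ r ≤ t + 1)
    (hbig : 4 ≤ big (1 ::ₘ (t + 1) ::ₘ R)) (hN : big (t ::ₘ R) < 4) :
    Good (1 ::ₘ (t + 1) ::ₘ R) ∨ Exceptional (1 ::ₘ (t + 1) ::ₘ R) := by
  simp only [big_cons] at hbig hN
  have ht : t = 2 ∧ big R = 3 := by split_ifs at hbig hN <;> omega
  obtain ⟨rfl, hR3⟩ := ht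
  obtain ⟨p, q, h⟩ := exists_eq_replicate hR
  rw [hR3] at h
  have hM : 1 ::ₘ (2 + 1) ::ₘ R = Multiset.replicate 4 3 +
      (Multiset.replicate p 2 + Multiset.replicate (q + 1) 1) := by
    rw [h, Multiset.replicate_succ 1 q, Multiset.replicate_succ 3 3, Multiset.add_cons,
      Multiset.add_cons, Multiset.cons_add]
  rw [hM] at hG ⊢
  exact good_or_exceptional_four_threes hG

/-- Parity makes `y` even, and the bound of a degree by the number of terms supplies enough terms 2
for `good_friendship`. -/
theorem good_of_three_threes {y p : ℕ} (hy : 3 ≤ y)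
    (hG : Graphic ((y + 1) ::ₘ (Multiset.replicate p 2 + Multiset.replicate 3 3))) :
    Good ((y + 1) ::ₘ (Multiset.replicate p 2 + Multiset.replicate 3 3)) := by
  have hlt := hG.lt_card (Multiset.mem_cons_self _ _)
  have heven := hG.even_sum
  simp only [Multiset.card_cons, Multiset.card_add, Multiset.card_replicate, Multiset.sum_cons,
    Multiset.sum_add, Multiset.sum_replicate, smul_eq_mul, Nat.even_iff] at hlt heven
  obtain ⟨h, rfl⟩ : ∃ h, y = 2 * h + 4 := ⟨(y - 4) / 2, by omega⟩
  obtain ⟨p, rfl⟩ : ∃ p', p = p' + 2 := ⟨p - 2, by omega⟩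
  exact good_friendship h p (by omega)

theorem good_or_exceptional_of_layOff_two {x y : ℕ} {R : Multiset ℕ}
    (hG : Graphic (2 ::ₘ (x + 1) ::ₘ (y + 1) ::ₘ R)) (hxy : x ≤ y)
    (hR : ∀ r ∈ R, 2 ≤ r ∧ r ≤ x + 1)
    (hbig : 4 ≤ big (2 ::ₘ (x + 1) ::ₘ (y + 1) ::ₘ R)) (hN : big (x ::ₘ y ::ₘ R) < 4) :
    Good (2 ::ₘ (x + 1) ::ₘ (y + 1) ::ₘ R) ∨
      Exceptional (2 ::ₘ (x + 1) ::ₘ (y + 1) ::ₘ R) := by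
  simp only [big_cons] at hbig hN
  have hR0 : x < 2 → big R = 0 := fun hx => Multiset.countP_eq_zero.2 fun r hr => by
    have := (hR r hr).2
    omega
  -- Some lowered term was a 3, and `x` is the smaller one; this bounds `R` by 3.
  have hx : x = 2 := by split_ifs at hbig hN <;> omega
  subst hx
  obtain ⟨p, q, h⟩ := exists_eq_replicate fun r hr =>
    ⟨le_trans one_le_two (hR r hr).1, (hR r hr).2⟩
  have hq : q = 0 := by
    by_contra hq
    have := (hR 1 (by rw [h]; simp [Multiset.mem_replicate, hq])).1
    omega
  rw [hq, Multiset.replicate_zero, add_zero] at h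
  by_cases hy : 3 ≤ y
  · have hc : big R = 2 := by split_ifs at hbig hN <;> omega
    rw [hc] at h
    have hM : 2 ::ₘ (2 + 1) ::ₘ (y + 1) ::ₘ R =
        (y + 1) ::ₘ (Multiset.replicate (p + 1) 2 + Multiset.replicate 3 3) := by
      rw [h, Multiset.replicate_succ 2 p, Multiset.replicate_succ 3 2, Multiset.add_cons,
        Multiset.cons_add, Multiset.cons_swap 3 (y + 1), Multiset.cons_swap 2 (y + 1),
        Multiset.cons_swap 2 3, add_comm (Multiset.replicate 2 3)]
    rw [hM] at hG ⊢
    exact Or.inl (good_of_three_threes hy hG)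
  · obtain rfl : y = 2 := by omega
    have hc : big R = 2 ∨ big R = 3 := by split_ifs at hbig hN <;> omega
    rcases hc with hc | hc
    · rw [hc] at h
      have hM : 2 ::ₘ (2 + 1) ::ₘ (2 + 1) ::ₘ R = Multiset.replicate 4 3 +
          (Multiset.replicate (p + 1) 2 + Multiset.replicate 0 1) := by
        rw [h, Multiset.replicate_succ 2 p, Multiset.replicate_succ 3 3,
          Multiset.replicate_succ 3 2, Multiset.replicate_zero, add_zero, Multiset.add_cons,
          Multiset.cons_add, Multiset.cons_add]
      rw [hM] at hG ⊢
      exact good_or_exceptional_four_threes hG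
    · have := hG.even_sum
      rw [h, hc] at this
      simp only [Multiset.sum_cons, Multiset.sum_add, Multiset.sum_replicate, smul_eq_mul,
        Nat.even_iff] at this
      omega

theorem good_or_exceptional_of_big_lt {T R : Multiset ℕ}
    (hG : Graphic (T.card ::ₘ (T.map Nat.succ + R)))
    (hmin : ∀ x ∈ T.card ::ₘ (T.map Nat.succ + R), T.card ≤ x) (hpos : T.card ≠ 0)
    (htop : ∀ t ∈ T, ∀ r ∈ R, r ≤ t + 1)
    (hbig : 4 ≤ big (T.card ::ₘ (T.map Nat.succ + R))) (hN : big (T + R) < 4) :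
    Good (T.card ::ₘ (T.map Nat.succ + R)) ∨ Exceptional (T.card ::ₘ (T.map Nat.succ + R)) := by
  have hminT : ∀ t ∈ T, T.card ≤ t + 1 := fun t ht =>
    hmin _ (Multiset.mem_cons_of_mem (Multiset.mem_add.2 (Or.inl (Multiset.mem_map_of_mem _ ht))))
  have hminR : ∀ r ∈ R, T.card ≤ r := fun r hr =>
    hmin _ (Multiset.mem_cons_of_mem (Multiset.mem_add.2 (Or.inr hr)))
  -- A smallest term `k ≥ 4` would leave `k` lowered terms that are still at least 3.
  have hlt : T.card < 4 := by
    by_contra hge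
    have hT : big T = T.card := big_eq_card fun t ht => by have := hminT t ht; omega
    rw [big_add] at hN
    omega
  obtain h | h | h : T.card = 1 ∨ T.card = 2 ∨ T.card = 3 := by omega
  · obtain ⟨t, rfl⟩ := Multiset.card_eq_one.1 h
    simp only [Multiset.card_singleton, Multiset.map_singleton, Multiset.singleton_add,
      Multiset.mem_singleton, forall_eq] at *
    exact good_or_exceptional_of_layOff_one hG (fun r hr => ⟨hminR r hr, htop r hr⟩) hbig hN
  · obtain ⟨x, y, rfl⟩ := Multiset.card_eq_two.1 h
    simp only [Multiset.insert_eq_cons, Multiset.map_cons, Multiset.card_cons,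
      Multiset.card_singleton, Multiset.map_singleton, Multiset.singleton_add, Multiset.cons_add,
      Multiset.mem_cons, Multiset.mem_singleton, forall_eq_or_imp, forall_eq] at *
    rcases le_total x y with hxy | hxy
    · exact good_or_exceptional_of_layOff_two hG hxy
        (fun r hr => ⟨hminR r hr, htop.1 r hr⟩) hbig hN
    · simp only [Nat.succ_eq_add_one] at *
      rw [Multiset.cons_swap (x + 1)] at *
      rw [Multiset.cons_swap x] at hN
      exact good_or_exceptional_of_layOff_two hG hxy
        (fun r hr => ⟨hminR r hr, htop.2 r hr⟩) hbig hN
  · obtain ⟨x, y, z, rfl⟩ := Multiset.card_eq_three.1 h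
    simp only [Multiset.insert_eq_cons, Multiset.map_cons, Multiset.card_cons,
      Multiset.card_singleton, Multiset.map_singleton, Multiset.singleton_add, Multiset.cons_add,
      Multiset.mem_cons, Multiset.mem_singleton, forall_eq_or_imp, forall_eq] at *
    exact good_or_exceptional_of_layOff_three hG (by omega) (by omega) (by omega)
      (fun r hr => hminR r hr) (fun r hr => ⟨htop.1 r hr, htop.2.1 r hr, htop.2.2 r hr⟩) hN

/-! ### The induction -/

/-- A graphic sequence with four terms that are at least three has a realization containing `K_4`
unless it is exceptional. -/
theorem good_or_exceptional {M : Multiset ℕ} (hG : Graphic M) (hpos : ∀ x ∈ M, 1 ≤ x)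
    (hbig : 4 ≤ big M) : Good M ∨ Exceptional M := by
  induction hn : M.card using Nat.strong_induction_on generalizing M with
  | _ n ih =>
  have hne : M ≠ 0 := by rintro rfl; simp [big] at hbig
  obtain ⟨T, R, rfl, hmin, htop⟩ := hG.exists_layOff hne hpos
  have hT0 : T.card ≠ 0 := by
    have := hpos _ (Multiset.mem_cons_self _ _)
    omega
  by_cases hN : big (T + R) < 4
  · exact good_or_exceptional_of_big_lt hG hmin hT0 htop hbig hN
  have hposN : ∀ x ∈ T + R, 1 ≤ x := by
    intro x hx
    rcases Multiset.mem_add.1 hx with hx | hx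
    -- A residual 0 comes from a term 1, so only one term was lowered and `R` is bounded by 1,
    -- contradicting `hN`.
    · by_contra h0
      obtain rfl : x = 0 := by omega
      have h1 := hmin 1 (by
        simp only [Multiset.mem_cons, Multiset.mem_add, Multiset.mem_map]
        exact Or.inr (Or.inl ⟨0, hx, rfl⟩))
      have hR : big R = 0 := Multiset.countP_eq_zero.2 fun r hr => by
        have := htop 0 hx r hr
        omega
      have : big T ≤ T.card := Multiset.countP_le_card _ _
      rw [big_add] at hN
      omega
    · exact hpos x (Multiset.mem_cons_of_mem (Multiset.mem_add.2 (Or.inr hx)))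
  have hlt : (T + R).card < n := by rw [← hn]; simp
  rcases ih _ hlt (hG.of_addVertex htop) hposN (not_lt.1 hN) rfl with
    h | ⟨l, hl, h⟩ | ⟨s, j, hs, h⟩
  · exact Or.inl h.addVertex
  · exact good_or_exceptional_of_layOff_known (List.mem_append_left _ hl) h hmin hT0 htop hbig
  · rcases j with _ | j
    · rcases hs with rfl | rfl
      · exact good_or_exceptional_of_layOff_known (l := [4, 3, 3, 3, 3]) (by decide) h hmin hT0
          htop hbig
      · exact good_or_exceptional_of_layOff_known (l := [5, 3, 3, 3, 3, 3]) (by decide) h hmin hT0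
          htop hbig
    · exact Or.inr (exceptional_of_layOff_wheelLike hs h hmin hT0 htop)

/-! ### Back to realizations on `Fin n` -/

theorem isRealization_iff {n : ℕ} (G : SimpleGraph (Fin n)) (d : Fin n → ℕ) :
    IsRealization G d ↔ ∀ i, deg G i = d i := by
  classical
  unfold IsRealization
  refine forall_congr' fun i => ?_
  rw [deg_eq_degree]

theorem deg_comap_equiv (e : W ≃ V) (G : SimpleGraph V) (w : W) :
    deg (G.comap e) w = deg G (e w) := by
  have : e '' (G.comap e).neighborSet w = G.neighborSet (e w) := by
    ext v
    simp only [Set.mem_image, mem_neighborSet, comap_adj]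
    exact ⟨by rintro ⟨u, hu, rfl⟩; exact hu, fun h => ⟨e.symm v, by simpa using h, by simp⟩⟩
  rw [deg, deg, ← this, Set.ncard_image_of_injective _ e.injective]

/-- Fibres over each value have equal size, so bijections between them can be glued. -/
theorem exists_equiv_of_map_univ_eq [Fintype V] [Fintype W] (f : V → ℕ) (g : W → ℕ)
    (h : Finset.univ.val.map f = Finset.univ.val.map g) : ∃ e : V ≃ W, ∀ v, g (e v) = f v := by
  classical
  have hfib : ∀ k, Nonempty ({v // f v = k} ≃ {w // g w = k}) := by
    intro k
    refine ⟨Fintype.equivOfCardEq ?_⟩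
    have := congrArg (Multiset.count k) h
    rw [Multiset.count_map, Multiset.count_map] at this
    rw [Fintype.card_subtype, Fintype.card_subtype, Finset.card_def, Finset.card_def,
      Finset.filter_val, Finset.filter_val]
    simpa only [eq_comm] using this
  exact ⟨Equiv.ofFiberEquiv fun k => (hfib k).some, fun v => Equiv.ofFiberEquiv_map _ v⟩

theorem Good.exists_realization {n : ℕ} {d : Fin n → ℕ} (h : Good (Finset.univ.val.map d)) :
    ∃ G : SimpleGraph (Fin n), IsRealization G d ∧ HasK4 G := by
  obtain ⟨V, _, G, hd, a, b, c, e, hK⟩ := h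
  obtain ⟨φ, hφ⟩ := exists_equiv_of_map_univ_eq d (deg G) hd.symm
  refine ⟨G.comap φ, (isRealization_iff _ _).2 fun i => (deg_comap_equiv φ G i).trans (hφ i),
    φ.symm a, φ.symm b, φ.symm c, φ.symm e, by simpa using hK⟩

/-- A `K_4` with a vertex of degree at least four extends to a copy of `K_5 - K_{1,3}`. -/
theorem isContained_of_K4 [Finite V] {G : SimpleGraph V} {a b c e : V} (hab : G.Adj a b)
    (hac : G.Adj a c) (hae : G.Adj a e) (hbc : G.Adj b c) (hbe : G.Adj b e) (hce : G.Adj c e)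
    (ha : 4 ≤ deg G a) : K5MinusK13 ⊑ G := by
  obtain ⟨x, hx, hxn⟩ : ∃ x, G.Adj a x ∧ x ∉ ({b, c, e} : Set V) := by
    by_contra! hcon
    have h1 : (G.neighborSet a).ncard ≤ ({b, c, e} : Set V).ncard :=
      Set.ncard_le_ncard hcon (Set.toFinite _)
    have h2 : ({b, c, e} : Set V).ncard = 3 :=
      Set.ncard_eq_three.2 ⟨b, c, e, hbc.ne, hbe.ne, hce.ne, rfl⟩
    unfold deg at ha
    omega
  simp only [Set.mem_insert_iff, Set.mem_singleton_iff, not_or] at hxn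
  obtain ⟨hxb, hxc, hxe⟩ := hxn
  have h1 := hab.ne
  have h2 := hac.ne
  have h3 := hae.ne
  have h4 := hbc.ne
  have h5 := hbe.ne
  have h6 := hce.ne
  have h7 := hx.ne
  -- The pendant vertex `0` goes to `x`, and `4`, the vertex adjacent to all others, goes to `a`.
  let f : Fin 5 → V := ![x, b, c, e, a]
  have hf : Function.Injective f := by
    intro i j hij
    fin_cases i <;> fin_cases j <;> simp [f] at hij ⊢ <;> tauto
  refine ⟨⟨⟨f, ?_⟩, hf⟩⟩
  intro i j hij
  have hsymm := fun u v => G.adj_comm u v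
  simp only [K5MinusK13, deleteEdges_adj, top_adj, Set.mem_insert_iff,
    Set.mem_singleton_iff, Sym2.eq_iff] at hij
  fin_cases i <;> fin_cases j <;> simp [f] at hij ⊢ <;> first | assumption | (rw [hsymm]; assumption)

/-! ### Exceptions have no `K_4` -/

theorem HasK4.exists_isNClique {G : SimpleGraph V} (h : HasK4 G) :
    ∃ A : Finset V, G.IsNClique 4 A := by
  classical
  obtain ⟨a, b, c, e, hab, hac, hae, hbc, hbe, hce⟩ := h
  refine ⟨{a, b, c, e}, ?_⟩
  have := hab.ne
  have := hac.ne
  have := hae.ne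
  have := hbc.ne
  have := hbe.ne
  have := hce.ne
  constructor
  · simp [isClique_iff, Set.pairwise_insert, *, G.adj_comm]
  · rw [Finset.card_eq_succ]
    refine ⟨a, {b, c, e}, by simp [*], rfl, Finset.card_eq_three.2 ⟨b, c, e, ?_, ?_, ?_, rfl⟩⟩ <;>
    assumption

theorem IsNClique.three_le_deg [Finite V] {G : SimpleGraph V} {A : Finset V}
    (hA : G.IsNClique 4 A) {x : V} (hx : x ∈ A) : 3 ≤ deg G x := by
  classical
  have h : ((A.erase x : Finset V) : Set V) ⊆ G.neighborSet x := fun y hy => by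
    rw [Finset.mem_coe, Finset.mem_erase] at hy
    exact hA.1 (by simpa using hx) (by simpa using hy.2) hy.1.symm
  have := Set.ncard_le_ncard h (Set.toFinite _)
  rw [Set.ncard_coe_finset, Finset.card_erase_of_mem hx, hA.2] at this
  exact this

/-- The Erdős–Gallai type inequality forced by a clique `A` of order four. -/
theorem IsNClique.sum_deg_le [Fintype V] [DecidableEq V] {G : SimpleGraph V} {A B : Finset V}
    (hA : G.IsNClique 4 A) (hAB : Disjoint A B) :
    ∑ b ∈ B, deg G b ≤
      B.card * (B.card - 1) + ∑ c ∈ (A ∪ B)ᶜ, deg G c + ∑ a ∈ A, (deg G a - 3) := by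
  classical
  have hdeg : ∀ v, deg G v = (Finset.univ.filter (G.Adj v)).card := fun v => by
    rw [deg_eq_degree, ← card_neighborFinset_eq_degree, neighborFinset_eq_filter]
  have hcount : ∀ X : Finset V, ∑ b ∈ B, (X.filter (G.Adj b)).card =
      ∑ x ∈ X, (B.filter (G.Adj x)).card := by
    intro X
    have := Finset.sum_card_bipartiteAbove_eq_sum_card_bipartiteBelow (s := B) (t := X) G.Adj
    simpa only [Finset.bipartiteAbove, Finset.bipartiteBelow, G.adj_comm] using this
  have hsplit : ∀ b ∈ B, deg G b ≤ (A.filter (G.Adj b)).card + (B.card - 1) +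
      ((A ∪ B)ᶜ.filter (G.Adj b)).card := by
    intro b hb
    have h1 : Finset.univ.filter (G.Adj b) ⊆
        A.filter (G.Adj b) ∪ B.erase b ∪ (A ∪ B)ᶜ.filter (G.Adj b) := by
      intro w hw
      have hw' : G.Adj b w := by simpa using hw
      have := hw'.ne'
      simp only [Finset.mem_union, Finset.mem_filter, Finset.mem_erase, Finset.mem_compl]
      tauto
    rw [hdeg]
    refine (Finset.card_le_card h1).trans ((Finset.card_union_le _ _).trans ?_)
    refine Nat.add_le_add_right ((Finset.card_union_le _ _).trans ?_) _
    rw [Finset.card_erase_of_mem hb]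
  -- Three of the edges at `a` stay inside the clique.
  have hAle : ∀ a ∈ A, (B.filter (G.Adj a)).card ≤ deg G a - 3 := by
    intro a ha
    have h1 : B.filter (G.Adj a) ∪ A.erase a ⊆ Finset.univ.filter (G.Adj a) := by
      intro w hw
      simp only [Finset.mem_union, Finset.mem_filter, Finset.mem_erase, Finset.mem_univ,
        true_and] at hw ⊢
      rcases hw with hw | hw
      · exact hw.2
      · exact hA.1 (by simpa using ha) (by simpa using hw.2) hw.1.symm
    have h2 : Disjoint (B.filter (G.Adj a)) (A.erase a) :=
      Finset.disjoint_of_subset_left (Finset.filter_subset _ _)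
        (Finset.disjoint_of_subset_right (Finset.erase_subset _ _) hAB.symm)
    have h3 := Finset.card_le_card h1
    rw [Finset.card_union_of_disjoint h2, Finset.card_erase_of_mem ha, hA.2, ← hdeg] at h3
    omega
  have hCle : ∀ c ∈ (A ∪ B)ᶜ, (B.filter (G.Adj c)).card ≤ deg G c := fun c _ => by
    rw [hdeg]
    exact Finset.card_le_card (Finset.filter_subset_filter _ (Finset.subset_univ _))
  calc ∑ b ∈ B, deg G b
      ≤ ∑ b ∈ B, ((A.filter (G.Adj b)).card + (B.card - 1) +
          ((A ∪ B)ᶜ.filter (G.Adj b)).card) := Finset.sum_le_sum hsplit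
    _ = ∑ a ∈ A, (B.filter (G.Adj a)).card + B.card * (B.card - 1) +
          ∑ c ∈ (A ∪ B)ᶜ, (B.filter (G.Adj c)).card := by
        rw [Finset.sum_add_distrib, Finset.sum_add_distrib, hcount, hcount, Finset.sum_const,
          smul_eq_mul]
    _ ≤ ∑ a ∈ A, (deg G a - 3) + B.card * (B.card - 1) + ∑ c ∈ (A ∪ B)ᶜ, deg G c :=
        add_le_add (add_le_add_left (Finset.sum_le_sum hAle) _) (Finset.sum_le_sum hCle)
    _ = _ := by ring

/-- The inequality `IsNClique.sum_deg_le` fails for every possible location of a `K_4`. -/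
def ViolatesK4 {n : ℕ} (d : Fin n → ℕ) : Prop :=
  ∀ A ∈ Finset.powersetCard 4 (Finset.univ : Finset (Fin n)),
    -- One choice of `B` serves all six sequences: every vertex off `A` whose degree is not one.
    let B := Finset.univ.filter fun i => i ∉ A ∧ 2 ≤ d i
    B.card * (B.card - 1) + ∑ c ∈ (A ∪ B)ᶜ, d c + ∑ a ∈ A, (d a - 3) < ∑ b ∈ B, d b

theorem ViolatesK4.not_hasK4 {n : ℕ} {d : Fin n → ℕ} (h : ViolatesK4 d)
    {G : SimpleGraph (Fin n)} (hG : IsRealization G d) : ¬ HasK4 G := by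
  intro hK
  obtain ⟨A, hA⟩ := hK.exists_isNClique
  have h1 := h A (Finset.mem_powersetCard.2 ⟨Finset.subset_univ _, hA.2⟩)
  have h2 := IsNClique.sum_deg_le (B := Finset.univ.filter fun i => i ∉ A ∧ 2 ≤ d i) hA
    (Finset.disjoint_left.2 fun i hi hB => (Finset.mem_filter.1 hB).2.1 hi)
  simp only [(isRealization_iff G d).1 hG] at h2
  exact absurd h1 (not_lt.2 h2)

/-- A graph with a dominating vertex all of whose other vertices have degree one or three, four or
five of them degree three, has no `K_4`. -/
theorem not_hasK4_of_dominating [Finite V] {G : SimpleGraph V} {v : V}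
    (hv : ∀ w, w ≠ v → G.Adj v w) (hdeg : ∀ w, w ≠ v → deg G w = 1 ∨ deg G w = 3) {S : Finset V}
    (hS : ∀ w, w ∈ S ↔ w ≠ v ∧ deg G w = 3) (h4 : 4 ≤ S.card) (h5 : S.card ≤ 5) : ¬ HasK4 G := by
  classical
  intro hK
  obtain ⟨A, hA⟩ := hK.exists_isNClique
  have hsub : ∀ x ∈ A, ((A.erase x : Finset V) : Set V) ⊆ G.neighborSet x := fun x hx y hy => by
    rw [Finset.mem_coe, Finset.mem_erase] at hy
    exact hA.1 (by simpa using hx) (by simpa using hy.2) hy.1.symm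
  -- A clique avoiding `v` would give its vertices degree at least four, as `v` dominates.
  have hvA : v ∈ A := by
    by_contra hvA
    obtain ⟨x, hx⟩ : A.Nonempty := by
      rw [← Finset.card_pos, hA.2]; norm_num
    have hxv : x ≠ v := by rintro rfl; exact hvA hx
    have h1 : ((insert v (A.erase x) : Finset V) : Set V) ⊆ G.neighborSet x := by
      rw [Finset.coe_insert]
      exact Set.insert_subset (hv x hxv).symm (hsub x hx)
    have h2 := Set.ncard_le_ncard h1 (Set.toFinite _)
    rw [Set.ncard_coe_finset, Finset.card_insert_of_notMem (by simp [hvA]),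
      Finset.card_erase_of_mem hx, hA.2] at h2
    have := hdeg x hxv
    unfold deg at this
    omega
  have hAS : A.erase v ⊆ S := by
    intro x hx
    rw [Finset.mem_erase] at hx
    have := IsNClique.three_le_deg hA hx.2
    exact (hS x).2 ⟨hx.1, by have := hdeg x hx.1; omega⟩
  have hA3 : (A.erase v).card = 3 := by rw [Finset.card_erase_of_mem hvA, hA.2]
  have hcard : (S \ A.erase v).card = S.card - 3 := by rw [Finset.card_sdiff_of_subset hAS, hA3]
  obtain ⟨w, hw⟩ : (S \ A.erase v).Nonempty := by
    rw [← Finset.card_pos, hcard]; omega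
  obtain ⟨hwS, hwA⟩ := Finset.mem_sdiff.1 hw
  obtain ⟨hwv, hw3⟩ := (hS w).1 hwS
  -- Vertices of degree one see only `v`, and those of `A.erase v` are saturated by the clique. So
  -- `w` has at most `v` and one other neighbour, too few for degree three.
  have hN : G.neighborSet w ⊆
      ((insert v ((S \ A.erase v).erase w) : Finset V) : Set V) := by
    intro u hu
    rw [mem_neighborSet] at hu
    rw [Finset.mem_coe, Finset.mem_insert, Finset.mem_erase, Finset.mem_sdiff]
    by_cases huv : u = v
    · exact Or.inl huv
    refine Or.inr ⟨hu.ne', (hS u).2 ⟨huv, (hdeg u huv).resolve_left fun h1 => ?_⟩, fun huA => ?_⟩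
    · obtain ⟨y, hy⟩ := Set.ncard_eq_one.1 h1
      have e1 : v ∈ G.neighborSet u := (hv u huv).symm
      have e2 : w ∈ G.neighborSet u := hu.symm
      rw [hy, Set.mem_singleton_iff] at e1 e2
      exact hwv (e2.trans e1.symm)
    · have huA' := (Finset.mem_erase.1 huA).2
      have hu3 := ((hS u).1 (hAS huA)).2
      have heq := Set.eq_of_subset_of_ncard_le (hsub u huA') (by
        rw [Set.ncard_coe_finset, Finset.card_erase_of_mem huA', hA.2]
        unfold deg at hu3
        omega) (Set.toFinite _)
      have e2 : w ∈ G.neighborSet u := hu.symm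
      rw [← heq, Finset.mem_coe, Finset.mem_erase] at e2
      exact hwA (Finset.mem_erase.2 ⟨hwv, e2.2⟩)
  have h1 := Set.ncard_le_ncard hN (Set.toFinite _)
  rw [Set.ncard_coe_finset] at h1
  have h2 := Finset.card_insert_le v ((S \ A.erase v).erase w)
  rw [Finset.card_erase_of_mem hw, hcard] at h2
  unfold deg at hw3
  omega

theorem not_hasK4_of_wheelLike {n : ℕ} {d : Fin n → ℕ} {s j : ℕ} (hs : s = 4 ∨ s = 5)
    (hd : List.ofFn d = (j + s) :: (List.replicate s 3 ++ List.replicate j 1))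
    {G : SimpleGraph (Fin n)} (hG : IsRealization G d) : ¬ HasK4 G := by
  have hn : n = j + s + 1 := by
    have := congrArg List.length hd
    simp at this
    omega
  subst hn
  rw [List.ofFn_succ, List.cons.injEq] at hd
  obtain ⟨hd0, hd⟩ := hd
  have hdeg := (isRealization_iff G d).1 hG
  have hmem : ∀ i : Fin (j + s), d i.succ = 3 ∨ d i.succ = 1 := fun i => by
    have : d i.succ ∈ List.ofFn fun i : Fin (j + s) => d i.succ := List.mem_ofFn.2 ⟨i, rfl⟩
    rw [hd, List.mem_append] at this
    exact this.imp List.eq_of_mem_replicate List.eq_of_mem_replicate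
  have hcard : (Finset.univ.filter fun i : Fin (j + s) => d i.succ = 3).card = s := by
    have h1 := congrArg (fun l : List ℕ => Multiset.count 3 (l : Multiset ℕ)) hd
    simp only [← Fin.univ_val_map, Multiset.count_map, Multiset.coe_count, List.count_append,
      List.count_replicate] at h1
    rw [Finset.card_def, Finset.filter_val]
    simpa [eq_comm] using h1
  refine not_hasK4_of_dominating (v := 0)
    (S := (Finset.univ.filter fun i : Fin (j + s) => d i.succ = 3).map (Fin.succEmb _))
    (fun w hw => ?_) (fun w hw => ?_) (fun w => ?_) ?_ ?_
  · have h1 : G.neighborSet 0 = {0}ᶜ := by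
      refine Set.eq_of_subset_of_ncard_le (fun u hu => ?_) ?_ (Set.toFinite _)
      · exact Set.mem_compl_singleton_iff.2 (G.ne_of_adj hu).symm
      · have h2 := Set.ncard_add_ncard_compl ({0} : Set (Fin (j + s + 1)))
        rw [Set.ncard_singleton, Nat.card_fin] at h2
        have h3 := hdeg 0
        unfold deg at h3
        omega
    rw [← mem_neighborSet, h1]
    exact hw
  · obtain ⟨i, rfl⟩ := Fin.exists_succ_eq.2 hw
    rw [hdeg]
    exact (hmem i).symm
  · rw [Finset.mem_map, hdeg]
    constructor
    · rintro ⟨i, hi, rfl⟩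
      exact ⟨Fin.succ_ne_zero i, (Finset.mem_filter.1 hi).2⟩
    · rintro ⟨hw, h3⟩
      obtain ⟨i, rfl⟩ := Fin.exists_succ_eq.2 hw
      exact ⟨i, by simpa using h3, rfl⟩
  · rw [Finset.card_map, hcard]; omega
  · rw [Finset.card_map, hcard]; omega

/-- Replacing `d` by `l.get` turns `ViolatesK4` into a closed statement that can be evaluated. -/
theorem not_hasK4_of_sporadic {n : ℕ} {d : Fin n → ℕ} {l : List ℕ} (hd : List.ofFn d = l)
    (hl : ViolatesK4 l.get) {G : SimpleGraph (Fin n)} (hG : IsRealization G d) : ¬ HasK4 G := by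
  have hn : n = l.length := by simpa using congrArg List.length hd
  subst hn
  have : d = l.get := List.ofFn_injective (hd.trans (List.ofFn_get l).symm)
  subst this
  exact hl.not_hasK4 hG

theorem violatesK4_four_threes_two : ViolatesK4 (List.get [4, 3, 3, 3, 3, 2]) := by
  unfold ViolatesK4; decide +kernel

theorem violatesK4_six_fours : ViolatesK4 (List.get [4, 4, 4, 4, 4, 4]) := by
  unfold ViolatesK4; decide +kernel

theorem violatesK4_two_fours_four_threes : ViolatesK4 (List.get [4, 4, 3, 3, 3, 3]) := by
  unfold ViolatesK4; decide +kernel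

theorem violatesK4_four_six_threes : ViolatesK4 (List.get [4, 3, 3, 3, 3, 3, 3]) := by
  unfold ViolatesK4; decide +kernel

theorem violatesK4_seven_fours : ViolatesK4 (List.get [4, 4, 4, 4, 4, 4, 4]) := by
  unfold ViolatesK4; decide +kernel

theorem violatesK4_four_five_threes_one : ViolatesK4 (List.get [4, 3, 3, 3, 3, 3, 1]) := by
  unfold ViolatesK4; decide +kernel

/-! ### Necessary conditions and sorted sequences -/

theorem hasK4_of_isContained [Finite V] {G : SimpleGraph V} (h : K5MinusK13 ⊑ G) :
    HasK4 G ∧ ∃ v, 4 ≤ deg G v := by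
  obtain ⟨f⟩ := h
  have hadj : ∀ i j, K5MinusK13.Adj i j → G.Adj (f i) (f j) := fun i j hij => f.toHom.map_adj hij
  have h4 : ∀ i : Fin 5, i ≠ 4 → K5MinusK13.Adj 4 i := by
    intro i hi
    fin_cases i <;> simp [K5MinusK13] at hi ⊢
  refine ⟨⟨f 4, f 1, f 2, f 3, hadj _ _ (h4 _ (by decide)), hadj _ _ (h4 _ (by decide)),
    hadj _ _ (h4 _ (by decide)), hadj _ _ ?_, hadj _ _ ?_, hadj _ _ ?_⟩, f 4, ?_⟩
  · simp [K5MinusK13]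
  · simp [K5MinusK13]
  · simp [K5MinusK13]
  · have h1 : f '' {4}ᶜ ⊆ G.neighborSet (f 4) := by
      rintro _ ⟨i, hi, rfl⟩
      exact hadj _ _ (h4 i hi)
    have h2 := Set.ncard_le_ncard h1 (Set.toFinite _)
    have h3 := Set.ncard_add_ncard_compl ({4} : Set (Fin 5))
    rw [Set.ncard_image_of_injective _ (show Function.Injective f from f.injective)] at h2
    rw [Set.ncard_singleton, Nat.card_fin] at h3
    unfold deg
    omega

theorem three_le_of_hasK4 {n : ℕ} (hn : 3 < n) {d : Fin n → ℕ} (hmono : Antitone d)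
    {G : SimpleGraph (Fin n)} (hG : IsRealization G d) (hK : HasK4 G) :
    3 ≤ d ⟨3, hn⟩ := by
  obtain ⟨A, hA⟩ := hK.exists_isNClique
  by_contra hlt
  -- Otherwise the four clique vertices, all of degree at least 3, would occupy only three
  -- positions.
  have hsmall : ∀ x ∈ A, x.val ∈ Finset.range 3 := by
    intro x hx
    have h3 := IsNClique.three_le_deg hA hx
    rw [(isRealization_iff G d).1 hG] at h3
    rw [Finset.mem_range]
    by_contra hge
    have : d x ≤ d ⟨3, hn⟩ := hmono (Fin.le_def.2 (not_lt.1 hge))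
    omega
  have := Finset.card_le_card_of_injOn _ hsmall Fin.val_injective.injOn
  rw [hA.2, Finset.card_range] at this
  omega

theorem four_le_big {n : ℕ} (hn : 3 < n) {d : Fin n → ℕ} (hmono : Antitone d)
    (h3 : 3 ≤ d ⟨3, hn⟩) : 4 ≤ big (Finset.univ.val.map d) := by
  rw [big, Multiset.countP_map, ← Finset.filter_val, ← Finset.card_def]
  have : (Finset.univ.map (Fin.castLEEmb (Nat.succ_le_of_lt hn))) ⊆
      Finset.univ.filter fun i => 3 ≤ d i := by
    intro i hi
    obtain ⟨k, -, rfl⟩ := Finset.mem_map.1 hi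
    refine Finset.mem_filter.2 ⟨Finset.mem_univ _, h3.trans (hmono ?_)⟩
    exact Fin.le_def.2 (Nat.le_of_lt_succ k.isLt)
  simpa using Finset.card_le_card this

theorem ofFn_eq_of_map_eq {n : ℕ} {d : Fin n → ℕ} (hmono : Antitone d) {l : List ℕ}
    (hl : l.Pairwise (· ≥ ·)) (h : Finset.univ.val.map d = l) : List.ofFn d = l := by
  rw [Fin.univ_val_map, Multiset.coe_eq_coe] at h
  refine h.eq_of_pairwise' ?_ hl
  rw [List.pairwise_ofFn]
  exact fun i j hij => hmono hij.le

theorem pairwise_wheelLike {s : ℕ} (hs : 4 ≤ s) (j : ℕ) :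
    ((j + s) :: (List.replicate s 3 ++ List.replicate j 1)).Pairwise (· ≥ ·) := by
  rw [List.pairwise_cons, List.pairwise_append]
  refine ⟨fun x hx => ?_, List.pairwise_replicate.2 (Or.inr le_rfl),
    List.pairwise_replicate.2 (Or.inr le_rfl), fun a ha b hb => ?_⟩
  · rcases List.mem_append.1 hx with hx | hx <;> rw [List.eq_of_mem_replicate hx] <;> omega
  · rw [List.eq_of_mem_replicate ha, List.eq_of_mem_replicate hb]; norm_num

theorem pairwise_sporadic : ∀ l ∈ sporadic, l.Pairwise (· ≥ ·) := by decide

end PotentialK4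

open PotentialK4

theorem theorem3p4 (n : ℕ) (hn : 5 ≤ n) (d : Fin n → ℕ)
    (hmono : Antitone d) (hpos : ∀ i, 0 < d i) (hgraphic : IsGraphic d) :
    IsPotentiallyGraphic K5MinusK13 d ↔
      (4 ≤ d ⟨0, by omega⟩ ∧ 3 ≤ d ⟨3, by omega⟩) ∧
      (List.ofFn d ≠ [4, 3, 3, 3, 3, 2] ∧
        List.ofFn d ≠ [4, 4, 4, 4, 4, 4] ∧
        List.ofFn d ≠ [4, 4, 3, 3, 3, 3] ∧
        List.ofFn d ≠ [4, 3, 3, 3, 3, 3, 3] ∧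
        List.ofFn d ≠ [4, 4, 4, 4, 4, 4, 4] ∧
        List.ofFn d ≠ [4, 3, 3, 3, 3, 3, 1] ∧
        List.ofFn d ≠ (n - 1) :: (List.replicate 4 3 ++ List.replicate (n - 5) 1) ∧
        (6 ≤ n →
          List.ofFn d ≠ (n - 1) :: (List.replicate 5 3 ++ List.replicate (n - 6) 1))) := by
  constructor
  · rintro ⟨G, hG, hH⟩
    obtain ⟨hK, v, hv⟩ := hasK4_of_isContained hH
    refine ⟨⟨?_, three_le_of_hasK4 (by omega) hmono hG hK⟩, ?_, ?_, ?_, ?_, ?_, ?_, ?_, ?_⟩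
    · rw [(isRealization_iff G d).1 hG] at hv
      exact hv.trans (hmono (Fin.le_def.2 (Nat.zero_le _)))
    · exact fun h => not_hasK4_of_sporadic h violatesK4_four_threes_two hG hK
    · exact fun h => not_hasK4_of_sporadic h violatesK4_six_fours hG hK
    · exact fun h => not_hasK4_of_sporadic h violatesK4_two_fours_four_threes hG hK
    · exact fun h => not_hasK4_of_sporadic h violatesK4_four_six_threes hG hK
    · exact fun h => not_hasK4_of_sporadic h violatesK4_seven_fours hG hK
    · exact fun h => not_hasK4_of_sporadic h violatesK4_four_five_threes_one hG hK
    · intro h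
      rw [show n - 1 = n - 5 + 4 by omega] at h
      exact not_hasK4_of_wheelLike (Or.inl rfl) h hG hK
    · intro hn6 h
      rw [show n - 1 = n - 6 + 5 by omega] at h
      exact not_hasK4_of_wheelLike (Or.inr rfl) h hG hK
  · rintro ⟨⟨h4, h3⟩, e1, e2, e3, e4, e5, e6, e7, e8⟩
    have hM : Graphic (Finset.univ.val.map d) := by
      obtain ⟨G, hG⟩ := hgraphic
      exact ⟨Fin n, inferInstance, G,
        Multiset.map_congr rfl fun i _ => (isRealization_iff G d).1 hG i⟩
    have hM1 : ∀ x ∈ Finset.univ.val.map d, 1 ≤ x := by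
      intro x hx
      obtain ⟨i, -, rfl⟩ := Multiset.mem_map.1 hx
      exact hpos i
    have hgood : Good (Finset.univ.val.map d) := by
      refine (good_or_exceptional hM hM1 (four_le_big (by omega) hmono h3)).resolve_right ?_
      rintro (⟨l, hl, h⟩ | ⟨s, j, hs, h⟩)
      · have hofFn := ofFn_eq_of_map_eq hmono (pairwise_sporadic l hl) h
        -- This discards the sporadic sequences with maximum 3; the other six are excluded by
        -- hypothesis.
        have hd0 : ∃ x ∈ l, 4 ≤ x :=
          ⟨_, by rw [← hofFn]; exact List.mem_ofFn.2 ⟨_, rfl⟩, h4⟩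
        simp only [sporadic, List.mem_cons, List.not_mem_nil, or_false] at hl
        rcases hl with rfl | rfl | rfl | rfl | rfl | rfl | rfl | rfl | rfl | rfl | rfl | rfl | rfl |
          rfl <;> contradiction
      · have hcard := congrArg Multiset.card h
        rw [wheelLike] at hcard
        simp only [Multiset.card_map, Finset.card_val, Finset.card_univ, Fintype.card_fin,
          Multiset.card_cons, Multiset.card_add, Multiset.card_replicate] at hcard
        have hofFn := ofFn_eq_of_map_eq hmono (pairwise_wheelLike (s := s) (by omega) j) (by
          rw [h, wheelLike]
          simp only [← Multiset.cons_coe, ← Multiset.coe_add, Multiset.coe_replicate])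
        rcases hs with rfl | rfl
        · refine e7 ?_
          rw [hofFn, show n - 1 = j + 4 by omega, show n - 5 = j by omega]
        · refine e8 (by omega) ?_
          rw [hofFn, show n - 1 = j + 5 by omega, show n - 6 = j by omega]
    obtain ⟨G, hG, hK⟩ := hgood.exists_realization
    obtain ⟨G', hdeg, a, b, c, e, ⟨hab, hac, hae, hbc, hbe, hce⟩, ha⟩ :=
      exists_K4_of_deg_ge_four G hK ⟨0, by omega⟩ (by rw [(isRealization_iff G d).1 hG]; exact h4)
    exact ⟨G', (isRealization_iff G' d).2 fun i => (hdeg i).trans ((isRealization_iff G d).1 hG i),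
      isContained_of_K4 hab hac hae hbc hbe hce ha⟩
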